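/- Let $M$ be a smooth manifold of dimension $n$ with tangent bundle $T$. Consider a gerbe with connective structure on $M$: an open cover $\{U_\alpha\}$, smooth functions $g_{\alpha\beta\gamma}:U_\alpha\cap U_\beta\cap U_\gamma\to S^1$, inverted by each transposition of the indices, with $g_{\beta\gamma\delta}g_{\alpha\gamma\delta}^{-1}g_{\alpha\beta\delta}g_{\alpha\beta\gamma}^{-1}=1$, and 1-forms $A_{\alpha\beta}$ on $U_\alpha\cap U_\beta$ with $A_{\alpha\beta}+A_{\beta\gamma}+A_{\gamma\alpha}=g_{\alpha\beta\gamma}^{-1}dg_{\alpha\beta\gamma}$ (where $\mathrm{Lie}(S^1)=i\mathbf R$ is identified with $\mathbf R$). Its generalized tangent bundle $E$, an extension $0\to T^*\to E\xrightarrow{\pi} T\to 0$, is obtained by identifying $T\oplus T^*$ over $U_\alpha$ with $T\oplus T^*$ over $U_\beta$ by $X+\xi\mapsto X+\xi+i_X\,dA_{\alpha\beta}$. It carries the inner product $(X+\xi,X+\xi)=i_X\xi$ and, on its sections, the Courant bracket, both defined in the local trivializations; the latter is $$[X+\xi,Y+\eta]=[X,Y]+\mathcal L_X\eta-\mathcal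 L_Y\xi-\tfrac12 d(i_X\eta-i_Y\xi).$$ Let $V\subset E$ be a generalized metric, that is, a smooth subbundle of rank $n$ on which the inner product is positive definite. The projection $\pi$ restricts to isomorphisms $V\cong T$ and $V^\perp\cong T$; for a vector field $X$ let $X^+$ and $X^-$ be its lifts to $V$ and $V^\perp$; if $X$ is smooth, these are smooth sections of $E$. Then: 1. $gX=\tfrac12(X^+-X^-)\in T^*$ defines a smooth Riemannian metric $g(X,Y)=(gX)(Y)$ on $M$. 2. The average of the two splittings, $X\mapsto \tfrac12(X^++X^-)=X+i_XB_\alpha$ over $U_\alpha$, is a curving of the connective structure: the $B_\alpha$ are smooth 2-forms on $U_\alpha$ with $B_\beta-B_\alpha=dA_{\alpha\beta}$ on $U_\alpha\cap U_\beta$. Hence $H=dB_\alpha$ is a globally defined 3-form, the curvature. 3. There is a smooth connection $\nabla$ on $T$ such that for all smooth vector fields $X,Y$ $$[X^-,Y^+]-[X,Y]^-=2g\nabla_XY\in\Omega^1(M),$$ where the first bracket is the Courant bracket and the second the Lie bracket. The connection $\nabla$ preserves $g$ and has skew torsion $-H$, in the convention that a connection has skew torsion $\tau$, for a 3-form $\tau$,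 if its torsion $T^\nabla(X,Y)=\nabla_XY-\nabla_YX-[X,Y]$ satisfies $g\,T^\nabla(X,Y)=i_Xi_Y\tau$. That is, $g\,T^\nabla(X,Y)=-i_Xi_YH$; as $(i_Xi_YH)(Z)=H(Y,X,Z)$, this says $g(T^\nabla(X,Y),Z)=H(X,Y,Z)$. -/

import Mathlib

open scoped Manifold ContDiff Topology

noncomputable section

namespace GenGeom

/-! ### Differential forms on a manifold modelled on `ℝⁿ` -/

section Forms

variable {n : ℕ} {M : Type*} [TopologicalSpace M] [ChartedSpace (EuclideanSpace ℝ (Fin n)) M]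

/-- Alternating `k`-linear forms on the tangent space `T_x M`. -/
abbrev FormAt (n : ℕ) {M : Type*} [TopologicalSpace M] [ChartedSpace (EuclideanSpace ℝ (Fin n)) M]
    (x : M) (k : ℕ) : Type :=
  TangentSpace (𝓡 n) x [⋀^Fin k]→L[ℝ] ℝ

/-- Differential `k`-forms on `M` (no regularity imposed). A form on an open subset `U` is
represented by a form on `M` whose values outside `U` are irrelevant. -/
abbrev DiffForm (n : ℕ) (M : Type*) [TopologicalSpace M]
    [ChartedSpace (EuclideanSpace ℝ (Fin n)) M] (k : ℕ) : Type _ :=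
  ∀ x : M, FormAt n x k

/-- Vector fields on `M` (no regularity imposed). -/
abbrev VField (n : ℕ) (M : Type*) [TopologicalSpace M]
    [ChartedSpace (EuclideanSpace ℝ (Fin n)) M] : Type _ :=
  ∀ x : M, TangentSpace (𝓡 n) x

/-- Smoothness of a vector field on a set. -/
def IsSmoothVFieldOn [IsManifold (𝓡 n) ∞ M] (X : VField n M) (U : Set M) : Prop :=
  ContMDiffOn (𝓡 n) (𝓡 n).tangent ∞ (fun x ↦ (⟨x, X x⟩ : TangentBundle (𝓡 n) M)) U

/-- Interior product `i_v φ = φ(v, ·, …, ·)` at a point. -/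
def interior {x : M} {k : ℕ} (v : TangentSpace (𝓡 n) x) (φ : FormAt n x (k + 1)) : FormAt n x k :=
  ContinuousAlternatingMap.curryLeft (E := EuclideanSpace ℝ (Fin n)) φ v

theorem interior_apply {x : M} {k : ℕ} (v : TangentSpace (𝓡 n) x) (φ : FormAt n x (k + 1))
    (w : Fin k → TangentSpace (𝓡 n) x) : interior v φ w = φ (Matrix.vecCons v w) := rfl

theorem interior_add {x : M} {k : ℕ} (v w : TangentSpace (𝓡 n) x) (φ : FormAt n x (k + 1)) :
    interior (v + w) φ = interior v φ + interior w φ :=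
  map_add (ContinuousAlternatingMap.curryLeft (E := EuclideanSpace ℝ (Fin n)) φ) v w

theorem interior_smul {x : M} {k : ℕ} (c : ℝ) (v : TangentSpace (𝓡 n) x)
    (φ : FormAt n x (k + 1)) : interior (c • v) φ = c • interior v φ :=
  map_smul (ContinuousAlternatingMap.curryLeft (E := EuclideanSpace ℝ (Fin n)) φ) c v

theorem interior_zero {x : M} {k : ℕ} (φ : FormAt n x (k + 1)) :
    interior (0 : TangentSpace (𝓡 n) x) φ = 0 :=
  map_zero (ContinuousAlternatingMap.curryLeft (E := EuclideanSpace ℝ (Fin n)) φ)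

/-- A one-form at `x` is additive in its argument. -/
theorem oneForm_add {x : M} (ξ : FormAt n x 1) (v w : TangentSpace (𝓡 n) x) :
    ξ ![v + w] = ξ ![v] + ξ ![w] := by
  simpa using ξ.map_vecCons_add (![] : Fin 0 → TangentSpace (𝓡 n) x) v w

/-- A one-form at `x` is homogeneous in its argument. -/
theorem oneForm_smul {x : M} (ξ : FormAt n x 1) (c : ℝ) (v : TangentSpace (𝓡 n) x) :
    ξ ![c • v] = c * ξ ![v] := by
  simpa using ξ.map_vecCons_smul (![] : Fin 0 → TangentSpace (𝓡 n) x) c v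

/-- The one-form at `x` given by a linear functional on `T_x M`. -/
def covectorOf {x : M} (f : TangentSpace (𝓡 n) x →ₗ[ℝ] ℝ) : FormAt n x 1 :=
  ContinuousAlternatingMap.ofSubsingleton ℝ (EuclideanSpace ℝ (Fin n)) ℝ (0 : Fin 1)
    (LinearMap.toContinuousLinearMap (E := EuclideanSpace ℝ (Fin n)) f)

theorem covectorOf_apply {x : M} (f : TangentSpace (𝓡 n) x →ₗ[ℝ] ℝ) (v : TangentSpace (𝓡 n) x) :
    covectorOf f ![v] = f v := rfl

/-- The form `φ` read in the preferred chart at `x₀`: the pullback of `φ` under the inverse of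
that chart. -/
def chartRep {k : ℕ} (φ : DiffForm n M k) (x₀ : M) :
    EuclideanSpace ℝ (Fin n) → EuclideanSpace ℝ (Fin n) [⋀^Fin k]→L[ℝ] ℝ := fun y ↦
  ContinuousAlternatingMap.compContinuousLinearMap
    (M' := TangentSpace 𝓘(ℝ, EuclideanSpace ℝ (Fin n)) y) (φ ((extChartAt (𝓡 n) x₀).symm y))
    (mfderiv 𝓘(ℝ, EuclideanSpace ℝ (Fin n)) (𝓡 n) (extChartAt (𝓡 n) x₀).symm y)

/-- Smoothness of a differential form on an open set: its chart representatives are smooth. -/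
def IsSmoothFormOn {k : ℕ} (φ : DiffForm n M k) (U : Set M) : Prop :=
  ∀ x₀ : M, ContDiffOn ℝ ∞ (chartRep φ x₀)
    ((extChartAt (𝓡 n) x₀).target ∩ (extChartAt (𝓡 n) x₀).symm ⁻¹' U)

/-- Exterior derivative, computed at `x` in the preferred chart at `x`. -/
def extD {k : ℕ} (φ : DiffForm n M k) : DiffForm n M (k + 1) := fun x ↦
  ContinuousAlternatingMap.compContinuousLinearMap
    (M := TangentSpace 𝓘(ℝ, EuclideanSpace ℝ (Fin n)) (extChartAt (𝓡 n) x x))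
    (extDeriv (chartRep φ x) (extChartAt (𝓡 n) x x))
    (mfderiv (𝓡 n) 𝓘(ℝ, EuclideanSpace ℝ (Fin n)) (extChartAt (𝓡 n) x) x)

/-- Lie derivative of a form of positive degree, `L_X φ = i_X dφ + d(i_X φ)`. -/
def lieDeriv {k : ℕ} (X : VField n M) (φ : DiffForm n M (k + 1)) : DiffForm n M (k + 1) := fun x ↦
  interior (X x) (extD φ x) + extD (fun y ↦ interior (X y) (φ y)) x

/-- The one-form part of the Courant bracket `[X + ξ, Y + η]` on `T ⊕ T*`, namely
`L_X η - L_Y ξ - ½ d(i_X η - i_Y ξ)`; the vector part is the Lie bracket `[X, Y]`. -/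
def courantForm (X : VField n M) (ξ : DiffForm n M 1) (Y : VField n M) (η : DiffForm n M 1) :
    DiffForm n M 1 := fun x ↦
  lieDeriv X η x - lieDeriv Y ξ x
    - (1 / 2 : ℝ) • extD (fun y ↦ interior (X y) (η y) - interior (Y y) (ξ y)) x

end Forms

/-! ### Gerbes with connective structure -/

/-- A gerbe with connective structure on `M`, relative to an open cover `U`: a smooth `S¹`-valued
2-cocycle `g` and one-forms `A α β` on the twofold overlaps with
`A α β + A β γ + A γ α = g⁻¹ dg` on the threefold overlaps, the Lie algebra `iℝ` of `S¹` being
identified with `ℝ`. -/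
structure ConnectiveGerbe (n : ℕ) (M : Type*) [TopologicalSpace M]
    [ChartedSpace (EuclideanSpace ℝ (Fin n)) M] (ι : Type*) where
  U : ι → Set M
  isOpen_U : ∀ α, IsOpen (U α)
  cover : ∀ x, ∃ α, x ∈ U α
  g : ι → ι → ι → M → Circle
  smooth_g : ∀ α β γ,
    ContMDiffOn (𝓡 n) 𝓘(ℝ, ℂ) ∞ (fun x ↦ (g α β γ x : ℂ)) (U α ∩ U β ∩ U γ)
  g_swap_left : ∀ α β γ, ∀ x ∈ U α ∩ U β ∩ U γ, g α β γ x = (g β α γ x)⁻¹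
  g_swap_right : ∀ α β γ, ∀ x ∈ U α ∩ U β ∩ U γ, g α β γ x = (g α γ β x)⁻¹
  cocycle : ∀ α β γ δ, ∀ x ∈ U α ∩ U β ∩ U γ ∩ U δ,
    g β γ δ x * (g α γ δ x)⁻¹ * g α β δ x * (g α β γ x)⁻¹ = 1
  A : ι → ι → DiffForm n M 1
  smooth_A : ∀ α β, IsSmoothFormOn (A α β) (U α ∩ U β)
  connective : ∀ α β γ, ∀ x ∈ U α ∩ U β ∩ U γ, ∀ v : TangentSpace (𝓡 n) x,
    Complex.I * (((A α β x + A β γ x + A γ α x) ![v] : ℝ) : ℂ) =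
      (g α β γ x : ℂ)⁻¹ * mvfderiv (𝓡 n) (fun y ↦ (g α β γ y : ℂ)) x v

namespace ConnectiveGerbe

variable {n : ℕ} {M : Type*} [TopologicalSpace M] [ChartedSpace (EuclideanSpace ℝ (Fin n)) M]
  {ι : Type*} (𝒢 : ConnectiveGerbe n M ι)

/-- A curving: two-forms `B α` on `U α` with `B β - B α = d(A α β)` on overlaps. -/
structure IsCurving (B : ι → DiffForm n M 2) : Prop where
  smooth : ∀ α, IsSmoothFormOn (B α) (𝒢.U α)
  sub_eq : ∀ α β, ∀ x ∈ 𝒢.U α ∩ 𝒢.U β, B β x - B α x = extD (𝒢.A α β) x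

/-- The indices of the sets of the cover that contain `x`. -/
abbrev IndexAt (x : M) : Type _ := {α : ι // x ∈ 𝒢.U α}

/-- One of the indices of the sets of the cover that contain `x`. -/
def indexAt (x : M) : 𝒢.IndexAt x := ⟨(𝒢.cover x).choose, (𝒢.cover x).choose_spec⟩

/-! ### The generalized tangent bundle -/

/-- The ambient space of the fibre at `x` of the generalized tangent bundle: a tangent vector, and
one covector for each set of the cover that contains `x`. -/
abbrev Ambient (x : M) : Type _ := TangentSpace (𝓡 n) x × (𝒢.IndexAt x → FormAt n x 1)

/-- The elements of the fibre at `x` of the generalized tangent bundle, as a subspace. -/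
def fibreSubmodule (x : M) : Submodule ℝ (𝒢.Ambient x) where
  carrier := {u | ∀ α β : 𝒢.IndexAt x, u.2 β = u.2 α + interior u.1 (extD (𝒢.A α β) x)}
  add_mem' := by
    intro a b ha hb α β
    change a.2 β + b.2 β = a.2 α + b.2 α + interior (a.1 + b.1) _
    rw [ha α β, hb α β, interior_add]
    abel
  zero_mem' := by
    intro α β
    change (0 : FormAt n x 1) = 0 + interior (0 : TangentSpace (𝓡 n) x) _
    rw [interior_zero, add_zero]
  smul_mem' := by
    intro c a ha α β
    change c • a.2 β = c • a.2 α + interior (c • a.1) _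
    rw [ha α β, interior_smul, smul_add]

/-- The fibre at `x` of the generalized tangent bundle `E`, obtained by identifying `T ⊕ T*` over
`U α` with `T ⊕ T*` over `U β` by `X + ξ ↦ X + ξ + i_X d(A α β)`. An element is given by all of its
representatives: a tangent vector `X` and, for each `U α` containing `x`, a covector `ξ α`, with
`ξ β = ξ α + i_X d(A α β)`. -/
def Fibre (x : M) : Type _ := 𝒢.fibreSubmodule x

instance (x : M) : AddCommGroup (𝒢.Fibre x) := inferInstanceAs (AddCommGroup (𝒢.fibreSubmodule x))

instance (x : M) : Module ℝ (𝒢.Fibre x) := inferInstanceAs (Module ℝ (𝒢.fibreSubmodule x))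

/-- The tuple of all representatives of an element of the fibre. -/
def toAmbient (x : M) : 𝒢.Fibre x →ₗ[ℝ] 𝒢.Ambient x := (𝒢.fibreSubmodule x).subtype

/-- The projection `π : E → T`. -/
def proj (x : M) : 𝒢.Fibre x →ₗ[ℝ] TangentSpace (𝓡 n) x :=
  (LinearMap.fst ℝ _ _).comp (𝒢.toAmbient x)

/-- The covector part of an element of `E` in the trivialization over `U α`. -/
def rep {x : M} (α : 𝒢.IndexAt x) : 𝒢.Fibre x →ₗ[ℝ] FormAt n x 1 :=
  ((LinearMap.proj α).comp (LinearMap.snd ℝ _ _)).comp (𝒢.toAmbient x)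

theorem rep_eq {x : M} (α β : 𝒢.IndexAt x) (u : 𝒢.Fibre x) :
    𝒢.rep β u = 𝒢.rep α u + interior (𝒢.proj x u) (extD (𝒢.A α β) x) := u.2 α β

theorem fibre_ext {x : M} {u v : 𝒢.Fibre x} (h : 𝒢.proj x u = 𝒢.proj x v)
    (α : 𝒢.IndexAt x) (hα : 𝒢.rep α u = 𝒢.rep α v) : u = v := by
  apply Subtype.ext
  refine Prod.ext h ?_
  funext β
  change 𝒢.rep β u = 𝒢.rep β v
  rw [𝒢.rep_eq α β u, 𝒢.rep_eq α β v, h, hα]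

/-- The inclusion `T* → E`. -/
def ofCovector (x : M) : FormAt n x 1 →ₗ[ℝ] 𝒢.Fibre x where
  toFun ξ := ⟨(0, fun _ ↦ ξ), fun α β ↦ by
    rw [interior_zero, add_zero]⟩
  map_add' ξ η := Subtype.ext (Prod.ext (add_zero _).symm rfl)
  map_smul' c ξ := Subtype.ext (Prod.ext (smul_zero c).symm rfl)

theorem proj_ofCovector {x : M} (ξ : FormAt n x 1) : 𝒢.proj x (𝒢.ofCovector x ξ) = 0 := rfl

theorem rep_ofCovector {x : M} (α : 𝒢.IndexAt x) (ξ : FormAt n x 1) :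
    𝒢.rep α (𝒢.ofCovector x ξ) = ξ := rfl

/-- The natural inner product on `E`, `(X + ξ, Y + η) = ½ (ξ(Y) + η(X))`, computed in one of the
trivializations at `x`. -/
def pairing {x : M} (u v : 𝒢.Fibre x) : ℝ :=
  (1 / 2) * (𝒢.rep (𝒢.indexAt x) u ![𝒢.proj x v] + 𝒢.rep (𝒢.indexAt x) v ![𝒢.proj x u])

/-- The inner product does not depend on the trivialization. -/
theorem pairing_eq {x : M} (α : 𝒢.IndexAt x) (u v : 𝒢.Fibre x) :
    𝒢.pairing u v = (1 / 2) * (𝒢.rep α u ![𝒢.proj x v] + 𝒢.rep α v ![𝒢.proj x u]) := by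
  unfold pairing
  rw [𝒢.rep_eq α (𝒢.indexAt x) u, 𝒢.rep_eq α (𝒢.indexAt x) v]
  have h : extD (𝒢.A α (𝒢.indexAt x)) x (![𝒢.proj x u, 𝒢.proj x v] ∘ (Equiv.swap (0 : Fin 2) 1))
      = - extD (𝒢.A α (𝒢.indexAt x)) x ![𝒢.proj x u, 𝒢.proj x v] :=
    (extD (𝒢.A α (𝒢.indexAt x)) x).toAlternatingMap.map_swap ![𝒢.proj x u, 𝒢.proj x v]
      (show (0 : Fin 2) ≠ 1 by decide)
  have h2 : (![𝒢.proj x u, 𝒢.proj x v] ∘ (Equiv.swap (0 : Fin 2) 1))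
      = ![𝒢.proj x v, 𝒢.proj x u] := by
    ext i; fin_cases i <;> rfl
  rw [h2] at h
  simp only [ContinuousAlternatingMap.add_apply, interior_apply]
  rw [h]
  ring

theorem pairing_comm {x : M} (u v : 𝒢.Fibre x) : 𝒢.pairing u v = 𝒢.pairing v u := by
  unfold pairing; rw [add_comm]

theorem pairing_add_left {x : M} (u u' v : 𝒢.Fibre x) :
    𝒢.pairing (u + u') v = 𝒢.pairing u v + 𝒢.pairing u' v := by
  unfold pairing
  simp only [map_add, oneForm_add, ContinuousAlternatingMap.add_apply]
  ring

theorem pairing_smul_left {x : M} (c : ℝ) (u v : 𝒢.Fibre x) :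
    𝒢.pairing (c • u) v = c * 𝒢.pairing u v := by
  unfold pairing
  simp only [map_smul, oneForm_smul, ContinuousAlternatingMap.smul_apply, smul_eq_mul]
  ring

theorem pairing_ofCovector {x : M} (ξ : FormAt n x 1) (v : 𝒢.Fibre x) :
    𝒢.pairing (𝒢.ofCovector x ξ) v = (1 / 2) * ξ ![𝒢.proj x v] := by
  unfold pairing
  have h : 𝒢.rep (𝒢.indexAt x) v ![(0 : TangentSpace (𝓡 n) x)] = 0 := by
    simpa using oneForm_smul (𝒢.rep (𝒢.indexAt x) v) 0 0
  rw [proj_ofCovector, rep_ofCovector, h, add_zero]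

open Classical in
/-- The one-form on `U α` representing a section of `E` (extended by zero). -/
def repForm (u : ∀ x, 𝒢.Fibre x) (α : ι) : DiffForm n M 1 := fun x ↦
  if h : x ∈ 𝒢.U α then 𝒢.rep ⟨α, h⟩ (u x) else 0

/-- Smoothness on an open set of a section of `E`: all its representatives `X + ξ α` are smooth. -/
structure IsSmoothSectionOn [IsManifold (𝓡 n) ∞ M] (u : ∀ x, 𝒢.Fibre x) (W : Set M) : Prop where
  proj : IsSmoothVFieldOn (fun x ↦ 𝒢.proj x (u x)) W
  rep : ∀ α, IsSmoothFormOn (𝒢.repForm u α) (𝒢.U α ∩ W)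

/-- The Courant bracket of two sections of `E`: over `U α` it is represented by the Courant
bracket of the representatives of the sections over `U α`. -/
def courantBracket (u v : ∀ x, 𝒢.Fibre x) (x : M) : 𝒢.Ambient x :=
  (VectorField.mlieBracket (𝓡 n) (fun y ↦ 𝒢.proj y (u y)) (fun y ↦ 𝒢.proj y (v y)) x,
    fun α ↦ courantForm (fun y ↦ 𝒢.proj y (u y)) (𝒢.repForm u α)
      (fun y ↦ 𝒢.proj y (v y)) (𝒢.repForm v α) x)

/-! ### Generalized metrics -/

theorem finrank_tangentSpace (x : M) : Module.finrank ℝ (TangentSpace (𝓡 n) x) = n :=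
  (finrank_euclideanSpace_fin : Module.finrank ℝ (EuclideanSpace ℝ (Fin n)) = n)

instance finiteDimensional_tangentSpace (x : M) : FiniteDimensional ℝ (TangentSpace (𝓡 n) x) :=
  inferInstanceAs (FiniteDimensional ℝ (EuclideanSpace ℝ (Fin n)))

/-- A generalized metric: a smooth subbundle `V ⊆ E` of rank `n = dim M` on which the inner
product is positive definite. -/
structure GeneralizedMetric [IsManifold (𝓡 n) ∞ M] where
  V : ∀ x, Submodule ℝ (𝒢.Fibre x)
  rank_eq : ∀ x, Module.finrank ℝ (V x) = n
  smooth : ∀ x₀, ∃ W : Set M, IsOpen W ∧ x₀ ∈ W ∧ ∃ s : Fin n → ∀ x, 𝒢.Fibre x,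
    (∀ i, 𝒢.IsSmoothSectionOn (s i) W) ∧
    ∀ x ∈ W, V x = Submodule.span ℝ (Set.range fun i ↦ s i x)
  pos : ∀ x, ∀ u ∈ V x, u ≠ 0 → 0 < 𝒢.pairing u u

namespace GeneralizedMetric

variable {𝒢} [IsManifold (𝓡 n) ∞ M] (V : 𝒢.GeneralizedMetric)

theorem plus_injective (x : M) : Function.Injective ((𝒢.proj x).domRestrict (V.V x)) := by
  rw [← LinearMap.ker_eq_bot, LinearMap.ker_eq_bot']
  rintro ⟨u, hu⟩ h
  have h : 𝒢.proj x u = 0 := h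
  by_contra hne
  have hp := V.pos x u hu (fun h0 ↦ hne (Subtype.ext h0))
  have hz : 𝒢.rep (𝒢.indexAt x) u ![(0 : TangentSpace (𝓡 n) x)] = 0 := by
    simpa using oneForm_smul (𝒢.rep (𝒢.indexAt x) u) 0 0
  rw [pairing, h, hz] at hp
  simp at hp

/-- The isomorphism `V ≅ T` given by the projection `E → T`. -/
def plusEquiv (x : M) : V.V x ≃ₗ[ℝ] TangentSpace (𝓡 n) x :=
  haveI : FiniteDimensional ℝ (V.V x) := FiniteDimensional.of_injective _ (V.plus_injective x)
  LinearEquiv.ofBijective ((𝒢.proj x).domRestrict (V.V x)) ⟨V.plus_injective x,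
    (LinearMap.injective_iff_surjective_of_finrank_eq_finrank
      ((V.rank_eq x).trans (finrank_tangentSpace x).symm)).1 (V.plus_injective x)⟩

/-- The lift `X ↦ X⁺` of tangent vectors to `V`. -/
def plus (x : M) : TangentSpace (𝓡 n) x →ₗ[ℝ] 𝒢.Fibre x :=
  (V.V x).subtype.comp (V.plusEquiv x).symm.toLinearMap

theorem plus_mem (x : M) (v : TangentSpace (𝓡 n) x) : V.plus x v ∈ V.V x :=
  ((V.plusEquiv x).symm v).2

theorem proj_plus (x : M) (v : TangentSpace (𝓡 n) x) : 𝒢.proj x (V.plus x v) = v :=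
  (V.plusEquiv x).apply_symm_apply v

theorem plus_proj (x : M) (u : 𝒢.Fibre x) (hu : u ∈ V.V x) : V.plus x (𝒢.proj x u) = u :=
  congrArg Subtype.val ((V.plusEquiv x).symm_apply_apply ⟨u, hu⟩)

/-- The orthogonal complement `V^⊥ ⊆ E`. -/
def perp (x : M) : Submodule ℝ (𝒢.Fibre x) where
  carrier := {u | ∀ v ∈ V.V x, 𝒢.pairing u v = 0}
  add_mem' := by
    intro a b ha hb v hv
    rw [pairing_add_left, ha v hv, hb v hv, add_zero]
  zero_mem' := by
    intro v _
    simpa using 𝒢.pairing_smul_left 0 0 v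
  smul_mem' := by
    intro c a ha v hv
    rw [pairing_smul_left, ha v hv, mul_zero]

theorem minus_injective (x : M) : Function.Injective ((𝒢.proj x).domRestrict (V.perp x)) := by
  rw [← LinearMap.ker_eq_bot, LinearMap.ker_eq_bot']
  rintro ⟨u, hu⟩ h
  have h : 𝒢.proj x u = 0 := h
  apply Subtype.ext
  have hu' : u = 𝒢.ofCovector x (𝒢.rep (𝒢.indexAt x) u) :=
    𝒢.fibre_ext (by rw [h, proj_ofCovector]) (𝒢.indexAt x) (by rw [rep_ofCovector])
  refine 𝒢.fibre_ext (by rw [h]; simp) (𝒢.indexAt x) ?_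
  ext w
  have hw := hu _ (V.plus_mem x (w 0))
  rw [hu', pairing_ofCovector, proj_plus] at hw
  have hw0 : w = ![w 0] := by ext i; fin_cases i; rfl
  rw [hw0]
  simp only [one_div, mul_eq_zero, inv_eq_zero, OfNat.ofNat_ne_zero, false_or] at hw
  simpa using hw

theorem minus_surjective (x : M) : Function.Surjective ((𝒢.proj x).domRestrict (V.perp x)) := by
  intro v
  let f : TangentSpace (𝓡 n) x →ₗ[ℝ] ℝ :=
    { toFun := fun w ↦ -2 * 𝒢.pairing (V.plus x w) (V.plus x v)
      map_add' := fun a b ↦ by rw [map_add, pairing_add_left]; ring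
      map_smul' := fun c a ↦ by
        rw [map_smul, pairing_smul_left, RingHom.id_apply, smul_eq_mul]; ring }
  refine ⟨⟨V.plus x v + 𝒢.ofCovector x (covectorOf f), fun w hw ↦ ?_⟩, ?_⟩
  · rw [pairing_add_left, pairing_ofCovector, covectorOf_apply]
    change _ + 1 / 2 * (-2 * 𝒢.pairing (V.plus x (𝒢.proj x w)) (V.plus x v)) = 0
    rw [V.plus_proj x w hw, 𝒢.pairing_comm w]
    ring
  · change 𝒢.proj x (V.plus x v + 𝒢.ofCovector x (covectorOf f)) = v
    rw [map_add, proj_plus, proj_ofCovector, add_zero]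

/-- The isomorphism `V^⊥ ≅ T` given by the projection `E → T`. -/
def minusEquiv (x : M) : V.perp x ≃ₗ[ℝ] TangentSpace (𝓡 n) x :=
  LinearEquiv.ofBijective ((𝒢.proj x).domRestrict (V.perp x))
    ⟨V.minus_injective x, V.minus_surjective x⟩

/-- The lift `X ↦ X⁻` of tangent vectors to `V^⊥`. -/
def minus (x : M) : TangentSpace (𝓡 n) x →ₗ[ℝ] 𝒢.Fibre x :=
  (V.perp x).subtype.comp (V.minusEquiv x).symm.toLinearMap

theorem minus_mem (x : M) (v : TangentSpace (𝓡 n) x) : V.minus x v ∈ V.perp x :=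
  ((V.minusEquiv x).symm v).2

theorem proj_minus (x : M) (v : TangentSpace (𝓡 n) x) : 𝒢.proj x (V.minus x v) = v :=
  (V.minusEquiv x).apply_symm_apply v

/-- Half the difference of the two splittings, as a map `T → T*`; this is the metric
`g : T → T*`, with `g(X, Y) = (gX)(Y)`. -/
def metric (x : M) : TangentSpace (𝓡 n) x →ₗ[ℝ] FormAt n x 1 :=
  (1 / 2 : ℝ) • (𝒢.rep (𝒢.indexAt x)).comp (V.plus x - V.minus x)

/-- `gX ∈ T* ⊆ E` is half the difference of the lifts of `X`. -/
theorem ofCovector_metric (x : M) (v : TangentSpace (𝓡 n) x) :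
    𝒢.ofCovector x (V.metric x v) = (1 / 2 : ℝ) • (V.plus x v - V.minus x v) := by
  refine 𝒢.fibre_ext ?_ (𝒢.indexAt x) ?_
  · rw [proj_ofCovector, map_smul, map_sub, proj_plus, proj_minus, sub_self, smul_zero]
  · rw [rep_ofCovector, map_smul]; rfl

/-- The metric is also the inner product of the lifts to `V`: `g(X, Y) = (X⁺, Y⁺)`. -/
theorem metric_apply (x : M) (v w : TangentSpace (𝓡 n) x) :
    V.metric x v ![w] = 𝒢.pairing (V.plus x v) (V.plus x w) := by
  have h := 𝒢.pairing_ofCovector (V.metric x v) (V.plus x w)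
  rw [ofCovector_metric, pairing_smul_left, proj_plus, sub_eq_add_neg, pairing_add_left,
    ← neg_one_smul ℝ, pairing_smul_left, V.minus_mem x v _ (V.plus_mem x w)] at h
  linarith

/-- The average of the two splittings. -/
def average (x : M) : TangentSpace (𝓡 n) x →ₗ[ℝ] 𝒢.Fibre x :=
  (1 / 2 : ℝ) • (V.plus x + V.minus x)

theorem proj_average (x : M) (v : TangentSpace (𝓡 n) x) : 𝒢.proj x (V.average x v) = v := by
  change 𝒢.proj x ((1 / 2 : ℝ) • (V.plus x v + V.minus x v)) = v
  rw [map_smul, map_add, proj_plus, proj_minus, ← two_smul ℝ v, smul_smul]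
  norm_num

theorem average_eq (x : M) (v : TangentSpace (𝓡 n) x) :
    V.average x v = V.plus x v + (-1 : ℝ) • 𝒢.ofCovector x (V.metric x v) := by
  rw [ofCovector_metric]
  change (1 / 2 : ℝ) • (V.plus x v + V.minus x v) = _
  module

/-- The average of the two splittings is isotropic. -/
theorem pairing_average (x : M) (v w : TangentSpace (𝓡 n) x) :
    𝒢.pairing (V.average x v) (V.average x w) = 0 := by
  have h1 : ∀ (ξ : FormAt n x 1) (u : 𝒢.Fibre x),
      𝒢.pairing u (𝒢.ofCovector x ξ) = (1 / 2) * ξ ![𝒢.proj x u] := fun ξ u ↦ by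
    rw [pairing_comm, pairing_ofCovector]
  rw [V.average_eq x v, pairing_add_left, pairing_smul_left, pairing_ofCovector, proj_average,
    V.average_eq x w, pairing_comm, pairing_add_left, pairing_smul_left, pairing_ofCovector,
    proj_plus, metric_apply, metric_apply, 𝒢.pairing_comm (V.plus x w)]
  ring

/-- The average of the two splittings in the trivialization over `U α`, as a map `T → T*`. -/
def averageRep {x : M} (α : 𝒢.IndexAt x) :
    EuclideanSpace ℝ (Fin n) →ₗ[ℝ] EuclideanSpace ℝ (Fin n) [⋀^Fin 1]→L[ℝ] ℝ :=
  (𝒢.rep α).comp (V.average x)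

/-- The two-form `B α` at a point of `U α` given by the average of the two splittings, which lifts
`X` to `X + i_X (B α)` in the trivialization over `U α`; see `interior_curvingAt`. -/
def curvingAt {x : M} (α : 𝒢.IndexAt x) : FormAt n x 2 :=
  (1 / 2 : ℝ) • ContinuousAlternatingMap.alternatizeUncurryFin (E := EuclideanSpace ℝ (Fin n))
    (LinearMap.toContinuousLinearMap (V.averageRep α))

theorem curvingAt_apply {x : M} (α : 𝒢.IndexAt x) (v w : TangentSpace (𝓡 n) x) :
    V.curvingAt α ![v, w] = (1 / 2 : ℝ) *
      (𝒢.rep α (V.average x v) ![w] - 𝒢.rep α (V.average x w) ![v]) := by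
  have h1 := ContinuousAlternatingMap.alternatizeUncurryFin_apply (E := EuclideanSpace ℝ (Fin n))
    (LinearMap.toContinuousLinearMap (V.averageRep α)) ![v, w]
  have e0 : Fin.removeNth (0 : Fin 2) ![v, w] = ![w] := by
    ext i; fin_cases i; rfl
  have e1 : Fin.removeNth (1 : Fin 2) ![v, w] = ![v] := by
    ext i; fin_cases i; rfl
  refine congrArg (fun t : ℝ ↦ (1 / 2 : ℝ) * t) (h1.trans ?_)
  rw [Fin.sum_univ_two]
  erw [e0, e1]
  change (-1 : ℤ) ^ 0 • 𝒢.rep α (V.average x v) ![w] +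
    (-1 : ℤ) ^ 1 • 𝒢.rep α (V.average x w) ![v] = _
  rw [pow_zero, pow_one, one_smul, neg_smul, one_smul, ← sub_eq_add_neg]

/-- The average of the two splittings lifts `X` to `X + i_X (B α)`. -/
theorem interior_curvingAt {x : M} (α : 𝒢.IndexAt x) (v : TangentSpace (𝓡 n) x) :
    interior v (V.curvingAt α) = 𝒢.rep α (V.average x v) := by
  ext w
  have hw0 : w = ![w 0] := by ext i; fin_cases i; rfl
  rw [hw0]
  generalize w 0 = w
  have h := V.pairing_average x v w
  rw [𝒢.pairing_eq α, proj_average, proj_average] at h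
  rw [interior_apply, curvingAt_apply]
  linarith

open Classical in
/-- The two-form `B α` on `U α` (extended by zero) given by the average of the two splittings. -/
def curving (α : ι) : DiffForm n M 2 := fun x ↦
  if h : x ∈ 𝒢.U α then V.curvingAt ⟨α, h⟩ else 0

/-- The curvature `H` of the curving, `H = d(B α)` on `U α`, computed at each point with one of the
`U α` that contain it. -/
def curvature : DiffForm n M 3 := fun x ↦ extD (V.curving (𝒢.indexAt x)) x

/-- A connection on the tangent bundle preserves the metric:
`X g(Y, Z) = g(∇_X Y, Z) + g(Y, ∇_X Z)`. -/
def IsMetricConnection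
    (D : CovariantDerivative (𝓡 n) (EuclideanSpace ℝ (Fin n)) (fun x : M ↦ TangentSpace (𝓡 n) x)) :
    Prop :=
  ∀ X Y Z : VField n M, IsSmoothVFieldOn X Set.univ → IsSmoothVFieldOn Y Set.univ →
    IsSmoothVFieldOn Z Set.univ → ∀ x : M,
    mvfderiv (𝓡 n) (fun y ↦ V.metric y (Y y) ![Z y]) x (X x) =
      V.metric x (D Y x (X x)) ![Z x] + V.metric x (Y x) ![D Z x (X x)]

/-- A connection on the tangent bundle has skew torsion `τ`, for a three-form `τ`: its torsion `T`
satisfies `g(T(X, Y)) = i_X i_Y τ`. As `(i_X i_Y τ)(Z) = τ(Y, X, Z)`, this convention means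
`g(T(X, Y), Z) = -τ(X, Y, Z)`. -/
def HasSkewTorsion
    (D : CovariantDerivative (𝓡 n) (EuclideanSpace ℝ (Fin n)) (fun x : M ↦ TangentSpace (𝓡 n) x))
    (τ : DiffForm n M 3) : Prop :=
  ∀ (x : M) (v w : TangentSpace (𝓡 n) x),
    V.metric x (D.torsion x v w) = interior v (interior w (τ x))

end GeneralizedMetric

end ConnectiveGerbe

end GenGeom

end

/-!
A frame of the subbundle `V` projects to a frame of `T`, because `π : V → T` is an isomorphism. So
the lift `X⁺` of a smooth field is a combination of the frame of `V` with smooth coefficients, and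
everything built from the lifts is smooth: first the metric `g(X, Y) = (X⁺, Y⁺)`, which gives
`X⁻ = X⁺ - 2gX`, then the two-forms `B_α` defined by `X⁺ = X + i_X B_α + gX` over `U α`
(`exists_plus_eq_sum`, `contMDiffAt_metric`, `isSmoothFormOn_curving`). The change of
trivialization of `E` is the equation `B_β - B_α = dA_{αβ}`, and `d² = 0` makes `H = dB_α` global
(`curving_sub_curving`, `extD_curving`).

Over `U α` the one-form part of `[X⁻, Y⁺] - [X, Y]⁻` is the Courant expression for
`ξ = i_X B_α - gX` and `η = i_Y B_α + gY`, less `i_{[X, Y]} B_α - g[X, Y]`. Evaluated on a field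
`Z`, Cartan's formula separates it into the terms containing `B_α`, which add up to
`dB_α(X, Y, Z) = H(X, Y, Z)`, and those containing `g`, which are the right-hand side of the
classical Koszul formula (`courantForm_sub_rep_minus`). The sum `koszul X Y Z` of the two is
tensorial in `X` and `Z` and satisfies a Leibniz rule in `Y`, so
`2 g(∇_X Y, Z) = koszul X Y Z` defines a connection `∇`, and the bracket formula holds by
construction. That `∇` preserves `g` and has torsion `H` are the two symmetries
`koszul_add_koszul_swap_right` and `koszul_sub_koszul_swap_left`.

The exterior derivative is defined in charts. The bridge to vector fields is the invariant formula
`extD_apply_vfield`, which rests on the chart independence `chartRep_extD`.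
-/

noncomputable section

set_option linter.unusedSectionVars false

namespace GenGeom

open Bundle VectorField

/-! ### Smooth families of multilinear maps on finite-dimensional spaces -/

section FiniteDimensional

variable {EM : Type*} [NormedAddCommGroup EM] [NormedSpace ℝ EM] {HM : Type*} [TopologicalSpace HM]
  {I : ModelWithCorners ℝ EM HM} {N : Type*} [TopologicalSpace N] [ChartedSpace HM N]

/-- A map into a finite-dimensional space is smooth as soon as its composites with finitely many
linear functionals separating the points are smooth. -/
theorem contMDiffAt_of_injective {W J : Type*} [NormedAddCommGroup W] [NormedSpace ℝ W] [Fintype J]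
    (ℓ : W →ₗ[ℝ] (J → ℝ)) (hℓ : Function.Injective ℓ) {f : N → W} {x : N} {r : ℕ∞ω}
    (h : ∀ j, ContMDiffAt I 𝓘(ℝ) r (fun y ↦ ℓ (f y) j) x) : ContMDiffAt I 𝓘(ℝ, W) r f x := by
  obtain ⟨m, hm⟩ := ℓ.exists_leftInverse_of_injective (LinearMap.ker_eq_bot.2 hℓ)
  have h1 : ContMDiffAt I 𝓘(ℝ, J → ℝ) r (fun y ↦ ℓ (f y)) x := contMDiffAt_pi_space.2 h
  have h2 := (LinearMap.toContinuousLinearMap m).contMDiff.contMDiffAt.comp x h1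
  refine h2.congr_of_eventuallyEq (Filter.Eventually.of_forall fun y ↦ ?_)
  exact (LinearMap.congr_fun hm (f y)).symm

/-- A family of continuous linear maps on a finite-dimensional space is smooth as soon as its values
at all vectors are. -/
theorem contMDiffAt_clm_of_apply {n : ℕ} {W : Type*} [NormedAddCommGroup W] [NormedSpace ℝ W]
    {f : N → EuclideanSpace ℝ (Fin n) →L[ℝ] W} {x : N} {r : ℕ∞ω}
    (h : ∀ v, ContMDiffAt I 𝓘(ℝ, W) r (fun y ↦ f y v) x) :
    ContMDiffAt I 𝓘(ℝ, EuclideanSpace ℝ (Fin n) →L[ℝ] W) r f x := by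
  set b := (EuclideanSpace.basisFun (Fin n) ℝ).toBasis
  -- a linear map is recovered from its values at the vectors of a basis
  have key : ∀ y, f y = ∑ i, (LinearMap.toContinuousLinearMap (b.coord i)).smulRight (f y (b i)) := by
    intro y
    ext v
    conv_lhs => rw [← b.sum_repr v, map_sum]
    simp
  rw [show f = fun y ↦ ∑ i, (LinearMap.toContinuousLinearMap (b.coord i)).smulRight (f y (b i)) from
    funext key]
  refine ContMDiffAt.sum fun i _ ↦ ?_
  exact ((ContinuousLinearMap.smulRightL ℝ (EuclideanSpace ℝ (Fin n)) W
    (LinearMap.toContinuousLinearMap (b.coord i))).contMDiff.contMDiffAt.comp x (h (b i)) :)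

/-- A family of alternating maps on a finite-dimensional space is smooth as soon as its values at
all tuples of vectors are. -/
theorem contMDiffAt_alternating_of_apply {n k : ℕ}
    {f : N → EuclideanSpace ℝ (Fin n) [⋀^Fin k]→L[ℝ] ℝ} {x : N} {r : ℕ∞ω}
    (h : ∀ v : Fin k → EuclideanSpace ℝ (Fin n), ContMDiffAt I 𝓘(ℝ) r (fun y ↦ f y v) x) :
    ContMDiffAt I 𝓘(ℝ, EuclideanSpace ℝ (Fin n) [⋀^Fin k]→L[ℝ] ℝ) r f x := by
  set b := (EuclideanSpace.basisFun (Fin n) ℝ).toBasis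
  refine contMDiffAt_of_injective (J := Fin k → Fin n)
    { toFun := fun φ w ↦ φ (fun i ↦ b (w i))
      map_add' := fun _ _ ↦ rfl
      map_smul' := fun _ _ ↦ rfl } ?_ fun w ↦ h _
  intro φ ψ hφψ
  apply ContinuousAlternatingMap.toAlternatingMap_injective
  exact b.ext_alternating fun w _ ↦ congrFun hφψ w

/-- Evaluation of a smooth family of alternating maps at smooth families of vectors is smooth. -/
theorem contMDiffAt_alternating_apply {F : Type*} [NormedAddCommGroup F] [NormedSpace ℝ F] {k : ℕ}
    {f : N → F [⋀^Fin k]→L[ℝ] ℝ} {v : Fin k → N → F} {x : N} {r : ℕ∞ω}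
    (hf : ContMDiffAt I 𝓘(ℝ, F [⋀^Fin k]→L[ℝ] ℝ) r f x)
    (hv : ∀ i, ContMDiffAt I 𝓘(ℝ, F) r (v i) x) :
    ContMDiffAt I 𝓘(ℝ) r (fun y ↦ f y (fun i ↦ v i y)) x := by
  induction k with
  | zero =>
    have := (ContinuousAlternatingMap.constOfIsEmptyLIE ℝ F ℝ (Fin 0)).symm.toContinuousLinearEquiv
      |>.contDiff.contMDiff.contMDiffAt.comp x hf
    refine this.congr_of_eventuallyEq (Filter.Eventually.of_forall fun y ↦ ?_)
    change f y (fun i ↦ v i y) = f y 0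
    congr 1
    exact Subsingleton.elim _ _
  | succ k ih =>
    have h0 : ContDiff ℝ r (fun φ : F [⋀^Fin (k + 1)]→L[ℝ] ℝ ↦ φ.curryLeft) :=
      ContinuousLinearMap.contDiff (𝕜 := ℝ) (F := F →L[ℝ] F [⋀^Fin k]→L[ℝ] ℝ)
        (ContinuousAlternatingMap.curryLeftLI (𝕜 := ℝ) (E := F) (F := ℝ)
          (n := k)).toContinuousLinearMap
    have h1 : ContMDiffAt I 𝓘(ℝ, F →L[ℝ] F [⋀^Fin k]→L[ℝ] ℝ) r (fun y ↦ (f y).curryLeft) x :=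
      h0.contMDiff.contMDiffAt.comp x hf
    have h2 := ih (h1.clm_apply (hv 0)) (fun i ↦ hv i.succ)
    refine h2.congr_of_eventuallyEq (Filter.Eventually.of_forall fun y ↦ ?_)
    change f y (fun i ↦ v i y) = f y (Matrix.vecCons (v 0 y) (fun i ↦ v i.succ y))
    congr 1
    ext i
    refine Fin.cases rfl (fun j ↦ rfl) i

end FiniteDimensional

section Forms

variable {n : ℕ} {M : Type*} [TopologicalSpace M] [ChartedSpace (EuclideanSpace ℝ (Fin n)) M]
  [IsManifold (𝓡 n) ∞ M]

/-! ### Vector fields in charts -/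

/-- Smoothness of a vector field at a point. -/
abbrev SmoothVFieldAt (X : VField n M) (x : M) : Prop :=
  ContMDiffAt (𝓡 n) (𝓡 n).tangent ∞ (fun y ↦ (⟨y, X y⟩ : TangentBundle (𝓡 n) M)) x

/-- Differentiability of a vector field at a point. -/
abbrev DiffVFieldAt (X : VField n M) (x : M) : Prop :=
  MDifferentiableAt (𝓡 n) (𝓡 n).tangent (fun y ↦ (⟨y, X y⟩ : TangentBundle (𝓡 n) M)) x

theorem SmoothVFieldAt.diff {X : VField n M} {x : M} (h : SmoothVFieldAt X x) : DiffVFieldAt X x :=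
  h.mdifferentiableAt (by simp)

theorem mfderiv_symm_mfderiv_extChartAt {x₀ x : M} (hx : x ∈ (extChartAt (𝓡 n) x₀).source)
    (v : EuclideanSpace ℝ (Fin n)) :
    (mfderiv 𝓘(ℝ, EuclideanSpace ℝ (Fin n)) (𝓡 n) (extChartAt (𝓡 n) x₀).symm
      (extChartAt (𝓡 n) x₀ x) :
        EuclideanSpace ℝ (Fin n) →L[ℝ] EuclideanSpace ℝ (Fin n))
      (mfderiv (𝓡 n) 𝓘(ℝ, EuclideanSpace ℝ (Fin n)) (extChartAt (𝓡 n) x₀) x v) = v := by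
  have := mfderivWithin_extChartAt_symm_comp_mfderiv_extChartAt' (I := 𝓡 n) hx
  rw [modelWithCornersSelf_coe, Set.range_id, mfderivWithin_univ] at this
  exact DFunLike.congr_fun this v

theorem mfderiv_mfderiv_symm_extChartAt {x₀ x : M} (hx : x ∈ (extChartAt (𝓡 n) x₀).source)
    (v : EuclideanSpace ℝ (Fin n)) :
    (mfderiv (𝓡 n) 𝓘(ℝ, EuclideanSpace ℝ (Fin n)) (extChartAt (𝓡 n) x₀) x :
        EuclideanSpace ℝ (Fin n) →L[ℝ] EuclideanSpace ℝ (Fin n))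
      (mfderiv 𝓘(ℝ, EuclideanSpace ℝ (Fin n)) (𝓡 n) (extChartAt (𝓡 n) x₀).symm
        (extChartAt (𝓡 n) x₀ x) v) = v := by
  have := mfderiv_extChartAt_comp_mfderivWithin_extChartAt_symm' (I := 𝓡 n) hx
  rw [modelWithCornersSelf_coe, Set.range_id, mfderivWithin_univ] at this
  exact DFunLike.congr_fun this v

/-- The components of a vector field in the preferred chart at `x₀`, as a function on `M`; they are
meaningful on the domain of that chart only. -/
def vfieldRep (x₀ : M) (X : VField n M) (y : M) : EuclideanSpace ℝ (Fin n) :=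
  mfderiv (𝓡 n) 𝓘(ℝ, EuclideanSpace ℝ (Fin n)) (extChartAt (𝓡 n) x₀) y (X y)

theorem snd_trivializationAt_eq {x₀ y : M} (hy : y ∈ (chartAt (EuclideanSpace ℝ (Fin n)) x₀).source)
    (X : VField n M) :
    (trivializationAt (EuclideanSpace ℝ (Fin n)) (TangentSpace (𝓡 n)) x₀ ⟨y, X y⟩).2
      = vfieldRep x₀ X y := by
  have h := TangentBundle.continuousLinearMapAt_trivializationAt (I := 𝓡 n) hy
  refine Eq.trans ?_ (DFunLike.congr_fun h (X y))
  exact (congrFun (Trivialization.coe_linearMapAt_of_mem (R := ℝ) _ (by simpa using hy)) _).symm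

theorem smoothVFieldAt_iff_vfieldRep {x₀ x : M} {X : VField n M}
    (hx : x ∈ (chartAt (EuclideanSpace ℝ (Fin n)) x₀).source) :
    SmoothVFieldAt X x ↔ ContMDiffAt (𝓡 n) 𝓘(ℝ, EuclideanSpace ℝ (Fin n)) ∞ (vfieldRep x₀ X) x := by
  refine (Trivialization.contMDiffAt_section_iff
    (trivializationAt (EuclideanSpace ℝ (Fin n)) (TangentSpace (𝓡 n)) x₀) (by simpa using hx)).trans
    (Filter.EventuallyEq.contMDiffAt_iff ?_)
  filter_upwards [(chartAt _ x₀).open_source.mem_nhds hx] with y hy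
  exact snd_trivializationAt_eq hy X

theorem DiffVFieldAt.vfieldRep {x₀ x : M} {X : VField n M}
    (hx : x ∈ (chartAt (EuclideanSpace ℝ (Fin n)) x₀).source) (h : DiffVFieldAt X x) :
    MDifferentiableAt (𝓡 n) 𝓘(ℝ, EuclideanSpace ℝ (Fin n)) (vfieldRep x₀ X) x := by
  refine ((Trivialization.mdifferentiableAt_section_iff (𝓡 n)
    (trivializationAt (EuclideanSpace ℝ (Fin n)) (TangentSpace (𝓡 n)) x₀) X (by simpa using hx)).1
    h).congr_of_eventuallyEq ?_
  filter_upwards [(chartAt _ x₀).open_source.mem_nhds hx] with y hy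
  exact (snd_trivializationAt_eq hy X).symm

/-- The vector field with constant components `v` in the preferred chart at `x₀`; it is meaningful on
the domain of that chart only. -/
def coordField (x₀ : M) (v : EuclideanSpace ℝ (Fin n)) : VField n M := fun y ↦
  mfderiv 𝓘(ℝ, EuclideanSpace ℝ (Fin n)) (𝓡 n) (extChartAt (𝓡 n) x₀).symm
    (extChartAt (𝓡 n) x₀ y) v

theorem coordField_smooth {x₀ x : M} (hx : x ∈ (chartAt (EuclideanSpace ℝ (Fin n)) x₀).source)
    (v : EuclideanSpace ℝ (Fin n)) : SmoothVFieldAt (coordField x₀ v) x := by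
  rw [smoothVFieldAt_iff_vfieldRep hx]
  refine (contMDiffAt_const (c := v)).congr_of_eventuallyEq ?_
  filter_upwards [(chartAt _ x₀).open_source.mem_nhds hx] with y hy
  exact mfderiv_mfderiv_symm_extChartAt (by simpa using hy) v

/-- Every tangent vector is the value of a smooth vector field. -/
theorem exists_smoothVFieldAt (x : M) (v : TangentSpace (𝓡 n) x) :
    ∃ X : VField n M, SmoothVFieldAt X x ∧ X x = v :=
  ⟨FiberBundle.extend (EuclideanSpace ℝ (Fin n)) v, FiberBundle.contMDiffAt_extend (𝓡 n) _ v,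
    FiberBundle.extend_apply_self _ v⟩

theorem coordField_add (x₀ y : M) (v w : EuclideanSpace ℝ (Fin n)) :
    coordField x₀ (v + w) y = coordField x₀ v y + coordField x₀ w y := map_add _ _ _

theorem coordField_const_smul (x₀ y : M) (c : ℝ) (v : EuclideanSpace ℝ (Fin n)) :
    coordField x₀ (c • v) y = c • coordField x₀ v y := map_smul _ _ _

/-! ### Smooth forms and smooth vector fields -/

/-- A form is recovered from its representative in any chart. -/
theorem chartRep_apply_mfderiv {k : ℕ} (φ : DiffForm n M k) {x₀ y : M}
    (hy : y ∈ (extChartAt (𝓡 n) x₀).source) (v : Fin k → EuclideanSpace ℝ (Fin n)) :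
    chartRep φ x₀ (extChartAt (𝓡 n) x₀ y) (fun i ↦
      mfderiv (𝓡 n) 𝓘(ℝ, EuclideanSpace ℝ (Fin n)) (extChartAt (𝓡 n) x₀) y (v i)) = φ y v := by
  have aux : ∀ y', y' = y → ∀ w : Fin k → EuclideanSpace ℝ (Fin n),
      (φ y' : EuclideanSpace ℝ (Fin n) [⋀^Fin k]→L[ℝ] ℝ) w = φ y w := by
    rintro y' rfl w; rfl
  refine (aux _ ((extChartAt (𝓡 n) x₀).left_inv hy) _).trans ?_
  congr 1
  funext i
  exact mfderiv_symm_mfderiv_extChartAt hy (v i)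

theorem apply_vfield_eventuallyEq {k : ℕ} (φ : DiffForm n M k) (X : Fin k → VField n M) {x₀ x : M}
    (hx : x ∈ (chartAt (EuclideanSpace ℝ (Fin n)) x₀).source) :
    (fun y ↦ φ y (fun i ↦ X i y)) =ᶠ[𝓝 x] fun y ↦
      chartRep φ x₀ (extChartAt (𝓡 n) x₀ y) (fun i ↦ vfieldRep x₀ (X i) y) := by
  filter_upwards [(chartAt _ x₀).open_source.mem_nhds hx] with y hy
  exact (chartRep_apply_mfderiv φ (by simpa using hy) _).symm

theorem chartSet_mem_nhds {U : Set M} (hU : IsOpen U) {x₀ x : M} (hx : x ∈ U)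
    (hx' : x ∈ (chartAt (EuclideanSpace ℝ (Fin n)) x₀).source) :
    (extChartAt (𝓡 n) x₀).target ∩ (extChartAt (𝓡 n) x₀).symm ⁻¹' U ∈
      𝓝 (extChartAt (𝓡 n) x₀ x) := by
  have hs : x ∈ (extChartAt (𝓡 n) x₀).source := by simpa using hx'
  refine Filter.inter_mem ((isOpen_extChartAt_target x₀).mem_nhds
    ((extChartAt (𝓡 n) x₀).map_source hs)) ?_
  refine (continuousAt_extChartAt_symm' hs).preimage_mem_nhds ?_
  rw [(extChartAt (𝓡 n) x₀).left_inv hs]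
  exact hU.mem_nhds hx

theorem IsSmoothFormOn.contDiffAt {k : ℕ} {φ : DiffForm n M k} {U : Set M}
    (hφ : IsSmoothFormOn φ U) (hU : IsOpen U) {x₀ x : M} (hx : x ∈ U)
    (hx' : x ∈ (chartAt (EuclideanSpace ℝ (Fin n)) x₀).source) :
    ContDiffAt ℝ ∞ (chartRep φ x₀) (extChartAt (𝓡 n) x₀ x) :=
  (hφ x₀).contDiffAt (chartSet_mem_nhds hU hx hx')

theorem contMDiffAt_extChartAt_of_mem {x₀ x : M}
    (hx : x ∈ (chartAt (EuclideanSpace ℝ (Fin n)) x₀).source) :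
    ContMDiffAt (𝓡 n) 𝓘(ℝ, EuclideanSpace ℝ (Fin n)) ∞ (extChartAt (𝓡 n) x₀) x :=
  contMDiffAt_extChartAt' hx

/-- A smooth form takes smooth values on smooth vector fields. -/
theorem IsSmoothFormOn.apply {k : ℕ} {φ : DiffForm n M k} {U : Set M}
    (hφ : IsSmoothFormOn φ U) (hU : IsOpen U) {x : M} (hx : x ∈ U) {X : Fin k → VField n M}
    (hX : ∀ i, SmoothVFieldAt (X i) x) :
    ContMDiffAt (𝓡 n) 𝓘(ℝ) ∞ (fun y ↦ φ y (fun i ↦ X i y)) x := by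
  have hxs := mem_chart_source (EuclideanSpace ℝ (Fin n)) x
  refine ContMDiffAt.congr_of_eventuallyEq ?_ (apply_vfield_eventuallyEq φ X hxs)
  exact contMDiffAt_alternating_apply
    ((hφ.contDiffAt hU hx hxs).contMDiffAt.comp x (contMDiffAt_extChartAt_of_mem hxs))
    fun i ↦ (smoothVFieldAt_iff_vfieldRep hxs).1 (hX i)

/-- A form is smooth if it takes smooth values on smooth vector fields. -/
theorem isSmoothFormOn_of_apply {k : ℕ} {φ : DiffForm n M k} {U : Set M}
    (h : ∀ x ∈ U, ∀ X : Fin k → VField n M, (∀ i, SmoothVFieldAt (X i) x) →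
      ContMDiffAt (𝓡 n) 𝓘(ℝ) ∞ (fun y ↦ φ y (fun i ↦ X i y)) x) : IsSmoothFormOn φ U := by
  rintro x₀ y ⟨hy, hyU⟩
  have hs : (extChartAt (𝓡 n) x₀).symm y ∈ (chartAt (EuclideanSpace ℝ (Fin n)) x₀).source := by
    simpa using (extChartAt (𝓡 n) x₀).map_target hy
  have hnhds := (isOpen_extChartAt_target (I := 𝓡 n) x₀).mem_nhds hy
  refine (contMDiffAt_iff_contDiffAt.1 (contMDiffAt_alternating_of_apply fun v ↦ ?_)).contDiffWithinAt
  have h1 := h _ hyU (fun i ↦ coordField x₀ (v i)) fun i ↦ coordField_smooth hs (v i)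
  have h2 := h1.comp y ((contMDiffOn_extChartAt_symm x₀).contMDiffAt hnhds)
  refine h2.congr_of_eventuallyEq ?_
  filter_upwards [hnhds] with z hz
  have h3 : ∀ z', z' = z → ∀ i, (mfderiv 𝓘(ℝ, EuclideanSpace ℝ (Fin n)) (𝓡 n)
      (extChartAt (𝓡 n) x₀).symm z (v i) : EuclideanSpace ℝ (Fin n)) =
      mfderiv 𝓘(ℝ, EuclideanSpace ℝ (Fin n)) (𝓡 n) (extChartAt (𝓡 n) x₀).symm z' (v i) := by
    rintro z' rfl i; rfl
  exact congrArg (φ ((extChartAt (𝓡 n) x₀).symm z)) (funext (h3 _ ((extChartAt (𝓡 n) x₀).right_inv hz)))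

theorem IsSmoothFormOn.apply_one {φ : DiffForm n M 1} {U : Set M}
    (hφ : IsSmoothFormOn φ U) (hU : IsOpen U) {x : M} (hx : x ∈ U) {X : VField n M}
    (hX : SmoothVFieldAt X x) : ContMDiffAt (𝓡 n) 𝓘(ℝ) ∞ (fun y ↦ φ y ![X y]) x := by
  refine (hφ.apply hU hx (X := fun _ ↦ X) (fun _ ↦ hX)).congr_of_eventuallyEq
    (Filter.Eventually.of_forall fun y ↦ ?_)
  exact congrArg (φ y) (funext fun i ↦ by fin_cases i; rfl)

theorem IsSmoothFormOn.apply_two {φ : DiffForm n M 2} {U : Set M}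
    (hφ : IsSmoothFormOn φ U) (hU : IsOpen U) {x : M} (hx : x ∈ U) {X Y : VField n M}
    (hX : SmoothVFieldAt X x) (hY : SmoothVFieldAt Y x) :
    ContMDiffAt (𝓡 n) 𝓘(ℝ) ∞ (fun y ↦ φ y ![X y, Y y]) x := by
  refine (hφ.apply hU hx (X := ![X, Y]) (fun i ↦ by
    fin_cases i; exacts [hX, hY])).congr_of_eventuallyEq
    (Filter.Eventually.of_forall fun y ↦ ?_)
  exact congrArg (φ y) (funext fun i ↦ by fin_cases i <;> rfl)

theorem IsSmoothFormOn.apply_three {φ : DiffForm n M 3} {U : Set M}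
    (hφ : IsSmoothFormOn φ U) (hU : IsOpen U) {x : M} (hx : x ∈ U) {X Y Z : VField n M}
    (hX : SmoothVFieldAt X x) (hY : SmoothVFieldAt Y x) (hZ : SmoothVFieldAt Z x) :
    ContMDiffAt (𝓡 n) 𝓘(ℝ) ∞ (fun y ↦ φ y ![X y, Y y, Z y]) x := by
  refine (hφ.apply hU hx (X := ![X, Y, Z]) (fun i ↦ by
    fin_cases i; exacts [hX, hY, hZ])).congr_of_eventuallyEq
    (Filter.Eventually.of_forall fun y ↦ ?_)
  exact congrArg (φ y) (funext fun i ↦ by fin_cases i <;> rfl)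

theorem isSmoothFormOn_one_of_apply {φ : DiffForm n M 1} {U : Set M}
    (h : ∀ x ∈ U, ∀ X : VField n M, SmoothVFieldAt X x →
      ContMDiffAt (𝓡 n) 𝓘(ℝ) ∞ (fun y ↦ φ y ![X y]) x) : IsSmoothFormOn φ U := by
  refine isSmoothFormOn_of_apply fun x hx X hX ↦ ?_
  refine (h x hx (X 0) (hX 0)).congr_of_eventuallyEq (Filter.Eventually.of_forall fun y ↦ ?_)
  exact congrArg (φ y) (funext fun i ↦ by fin_cases i; rfl)

theorem isSmoothFormOn_two_of_apply {φ : DiffForm n M 2} {U : Set M}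
    (h : ∀ x ∈ U, ∀ X Y : VField n M, SmoothVFieldAt X x → SmoothVFieldAt Y x →
      ContMDiffAt (𝓡 n) 𝓘(ℝ) ∞ (fun y ↦ φ y ![X y, Y y]) x) : IsSmoothFormOn φ U := by
  refine isSmoothFormOn_of_apply fun x hx X hX ↦ ?_
  refine (h x hx (X 0) (X 1) (hX 0) (hX 1)).congr_of_eventuallyEq
    (Filter.Eventually.of_forall fun y ↦ ?_)
  exact congrArg (φ y) (funext fun i ↦ by fin_cases i <;> rfl)

theorem oneForm_ext {x : M} {ξ η : FormAt n x 1} (h : ∀ v : TangentSpace (𝓡 n) x, ξ ![v] = η ![v]) :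
    ξ = η := by
  refine ContinuousAlternatingMap.ext fun w ↦ ?_
  have hw0 : w = ![w 0] := by funext i; fin_cases i; rfl
  rw [hw0]
  exact h _

theorem twoForm_ext {x : M} {ξ η : FormAt n x 2}
    (h : ∀ v w : TangentSpace (𝓡 n) x, ξ ![v, w] = η ![v, w]) : ξ = η := by
  refine ContinuousAlternatingMap.ext fun w ↦ ?_
  have hw0 : w = ![w 0, w 1] := by funext i; fin_cases i <;> rfl
  rw [hw0]
  exact h _ _

/-! ### The exterior derivative on a manifold -/

theorem two_le_infty : minSmoothness ℝ 2 ≤ (∞ : ℕ∞ω) := by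
  rw [minSmoothness_of_isRCLikeNormedField]
  exact WithTop.coe_le_coe.2 (le_top : (2 : ℕ∞) ≤ ⊤)

/-- The exterior derivative may be computed in any chart. -/
theorem chartRep_extD {k : ℕ} {φ : DiffForm n M k} {U : Set M} (hφ : IsSmoothFormOn φ U)
    (hU : IsOpen U) (x₀ : M) {y : EuclideanSpace ℝ (Fin n)}
    (hy : y ∈ (extChartAt (𝓡 n) x₀).target ∩ (extChartAt (𝓡 n) x₀).symm ⁻¹' U) :
    chartRep (extD φ) x₀ y = extDeriv (chartRep φ x₀) y := by
  obtain ⟨hy, hyU⟩ := hy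
  set x := (extChartAt (𝓡 n) x₀).symm y with hx
  have hxs := mem_chart_source (EuclideanSpace ℝ (Fin n)) x
  have hnhds := (isOpen_extChartAt_target (I := 𝓡 n) x₀).mem_nhds hy
  -- the transition map from the chart at `x₀` to the preferred chart at `x`
  set τ : EuclideanSpace ℝ (Fin n) → EuclideanSpace ℝ (Fin n) :=
    fun z ↦ extChartAt (𝓡 n) x ((extChartAt (𝓡 n) x₀).symm z) with hτ
  have hsymm : ∀ z ∈ (extChartAt (𝓡 n) x₀).target, ContMDiffAt 𝓘(ℝ, EuclideanSpace ℝ (Fin n)) (𝓡 n)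
      ∞ (extChartAt (𝓡 n) x₀).symm z := fun z hz ↦
    (contMDiffOn_extChartAt_symm x₀).contMDiffAt ((isOpen_extChartAt_target x₀).mem_nhds hz)
  have hev : ∀ᶠ z in 𝓝 y, z ∈ (extChartAt (𝓡 n) x₀).target ∧
      (extChartAt (𝓡 n) x₀).symm z ∈ (chartAt (EuclideanSpace ℝ (Fin n)) x).source :=
    Filter.Eventually.and hnhds ((hsymm y hy).continuousAt.preimage_mem_nhds
      ((chartAt _ x).open_source.mem_nhds hxs))
  have hderiv : ∀ z, z ∈ (extChartAt (𝓡 n) x₀).target →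
      (extChartAt (𝓡 n) x₀).symm z ∈ (chartAt (EuclideanSpace ℝ (Fin n)) x).source →
      fderiv ℝ τ z = (mfderiv (𝓡 n) 𝓘(ℝ, EuclideanSpace ℝ (Fin n)) (extChartAt (𝓡 n) x)
        ((extChartAt (𝓡 n) x₀).symm z)).comp (mfderiv 𝓘(ℝ, EuclideanSpace ℝ (Fin n)) (𝓡 n)
        (extChartAt (𝓡 n) x₀).symm z) := fun z hz hz' ↦ by
    rw [← mfderiv_eq_fderiv]
    exact mfderiv_comp z ((contMDiffAt_extChartAt_of_mem hz').mdifferentiableAt (by simp))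
      ((hsymm z hz).mdifferentiableAt (by simp))
  have hrep : chartRep φ x₀ =ᶠ[𝓝 y]
      fun z ↦ (chartRep φ x (τ z)).compContinuousLinearMap (fderiv ℝ τ z) := by
    filter_upwards [hev] with z hz
    ext w
    rw [ContinuousAlternatingMap.compContinuousLinearMap_apply, hderiv z hz.1 hz.2]
    exact (chartRep_apply_mfderiv φ (x₀ := x) (by simpa using hz.2) _).symm
  have hτs : ContDiffAt ℝ ∞ τ y := by
    rw [← contMDiffAt_iff_contDiffAt]
    exact (contMDiffAt_extChartAt_of_mem hxs).comp y (hsymm y hy)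
  rw [hrep.extDeriv_eq, extDeriv_pullback (f := τ) (r := ∞)
    ((hφ.contDiffAt hU hyU hxs).differentiableAt (by simp)) hτs two_le_infty, hderiv y hy hxs]
  rfl

/-- The exterior derivative of a smooth form is smooth. -/
theorem IsSmoothFormOn.extD {k : ℕ} {φ : DiffForm n M k} {U : Set M} (hφ : IsSmoothFormOn φ U)
    (hU : IsOpen U) : IsSmoothFormOn (extD φ) U := by
  rintro x₀ y hy
  have hmem : (extChartAt (𝓡 n) x₀).target ∩ (extChartAt (𝓡 n) x₀).symm ⁻¹' U ∈ 𝓝 y :=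
    Filter.inter_mem ((isOpen_extChartAt_target x₀).mem_nhds hy.1)
      ((continuousAt_extChartAt_symm'' hy.1).preimage_mem_nhds (hU.mem_nhds hy.2))
  have h1 : ContDiffAt ℝ ∞ (fderiv ℝ (chartRep φ x₀)) y :=
    ((hφ x₀).contDiffAt hmem).fderiv_right (by simp)
  have h0 : ContDiff ℝ ∞ (fun f : EuclideanSpace ℝ (Fin n) →L[ℝ]
      EuclideanSpace ℝ (Fin n) [⋀^Fin k]→L[ℝ] ℝ ↦
        ContinuousAlternatingMap.alternatizeUncurryFin f) :=
    ContinuousLinearMap.contDiff (𝕜 := ℝ) (E := EuclideanSpace ℝ (Fin n) →L[ℝ]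
      EuclideanSpace ℝ (Fin n) [⋀^Fin k]→L[ℝ] ℝ)
      (ContinuousAlternatingMap.alternatizeUncurryFinCLM ℝ (EuclideanSpace ℝ (Fin n)) ℝ)
  have h2 : ContDiffAt ℝ ∞ (extDeriv (chartRep φ x₀)) y := h0.contDiffAt.comp y h1
  refine (h2.congr_of_eventuallyEq ?_).contDiffWithinAt
  filter_upwards [hmem] with z hz
  exact chartRep_extD hφ hU x₀ hz

/-- `d ∘ d = 0`. -/
theorem extD_extD {k : ℕ} {φ : DiffForm n M k} {U : Set M} (hφ : IsSmoothFormOn φ U)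
    (hU : IsOpen U) {x : M} (hx : x ∈ U) : GenGeom.extD (GenGeom.extD φ) x = 0 := by
  have hxs := mem_chart_source (EuclideanSpace ℝ (Fin n)) x
  have h : chartRep (GenGeom.extD φ) x =ᶠ[𝓝 (extChartAt (𝓡 n) x x)] extDeriv (chartRep φ x) := by
    filter_upwards [chartSet_mem_nhds hU hx hxs] with z hz
    exact chartRep_extD hφ hU x hz
  have h0 := extDeriv_extDeriv_apply (hφ.contDiffAt hU hx hxs) two_le_infty
  rw [← h.extDeriv_eq] at h0
  unfold GenGeom.extD at h0 ⊢
  rw [h0]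
  rfl

theorem mpullbackWithin_extChartAt_symm_eventuallyEq (X : VField n M) (x : M) :
    VectorField.mpullbackWithin 𝓘(ℝ, EuclideanSpace ℝ (Fin n)) (𝓡 n) (extChartAt (𝓡 n) x).symm X
      (Set.range (𝓡 n)) =ᶠ[𝓝 (extChartAt (𝓡 n) x x)]
      fun z ↦ vfieldRep x X ((extChartAt (𝓡 n) x).symm z) := by
  filter_upwards [extChartAt_target_mem_nhds x] with z hz
  have hs := (extChartAt (𝓡 n) x).map_target hz
  have h1 := mfderivWithin_extChartAt_symm_comp_mfderiv_extChartAt' (I := 𝓡 n) hs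
  have h2 := mfderiv_extChartAt_comp_mfderivWithin_extChartAt_symm' (I := 𝓡 n) hs
  rw [(extChartAt (𝓡 n) x).right_inv hz] at h1
  rw [(extChartAt (𝓡 n) x).right_inv hz] at h2
  rw [VectorField.mpullbackWithin_apply, vfieldRep]
  exact DFunLike.congr_fun (ContinuousLinearMap.inverse_eq h1 h2) _

/-- The Lie bracket of vector fields on `M`, computed in a chart. -/
theorem mlieBracket_rep (X Y : VField n M) (x : M) :
    (mfderiv (𝓡 n) 𝓘(ℝ, EuclideanSpace ℝ (Fin n)) (extChartAt (𝓡 n) x) x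
      (VectorField.mlieBracket (𝓡 n) X Y x) : EuclideanSpace ℝ (Fin n)) =
    VectorField.lieBracket ℝ (fun z ↦ vfieldRep x X ((extChartAt (𝓡 n) x).symm z))
      (fun z ↦ vfieldRep x Y ((extChartAt (𝓡 n) x).symm z)) (extChartAt (𝓡 n) x x) := by
  have h := VectorField.mlieBracketWithin_apply (I := 𝓡 n) (V := X) (W := Y) (s := Set.univ)
    (x₀ := x)
  rw [VectorField.mlieBracketWithin_univ] at h
  have hr : (extChartAt (𝓡 n) x).symm ⁻¹' Set.univ ∩ Set.range (𝓡 n) = Set.univ := by simp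
  have h2 := Filter.EventuallyEq.lieBracket_vectorField_eq (𝕜 := ℝ)
    (E := EuclideanSpace ℝ (Fin n)) (mpullbackWithin_extChartAt_symm_eventuallyEq X x)
    (mpullbackWithin_extChartAt_symm_eventuallyEq Y x)
  refine (congrArg (mfderiv (𝓡 n) 𝓘(ℝ, EuclideanSpace ℝ (Fin n)) (extChartAt (𝓡 n) x) x) h).trans ?_
  refine ((isInvertible_mfderiv_extChartAt (mem_extChartAt_source x)).self_apply_inverse _).trans ?_
  rw [hr]
  refine Eq.trans (congrFun (VectorField.lieBracketWithin_univ (𝕜 := ℝ)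
    (E := EuclideanSpace ℝ (Fin n))) _) h2

theorem hasMFDerivAt_of_eventuallyEq_chart {f : M → ℝ} {F : EuclideanSpace ℝ (Fin n) → ℝ} {x : M}
    (hf : f =ᶠ[𝓝 x] fun y ↦ F (extChartAt (𝓡 n) x y))
    (hF : DifferentiableAt ℝ F (extChartAt (𝓡 n) x x)) :
    HasMFDerivAt (𝓡 n) 𝓘(ℝ) f x ((fderiv ℝ F (extChartAt (𝓡 n) x x)).comp
      (mfderiv (𝓡 n) 𝓘(ℝ, EuclideanSpace ℝ (Fin n)) (extChartAt (𝓡 n) x) x)) := by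
  have h1 : MDifferentiableAt (𝓡 n) 𝓘(ℝ, EuclideanSpace ℝ (Fin n)) (extChartAt (𝓡 n) x) x :=
    mdifferentiableAt_extChartAt (mem_chart_source _ x)
  exact (hF.hasFDerivAt.hasMFDerivAt.comp x h1.hasMFDerivAt).congr_of_eventuallyEq hf

/-- Evaluating the exterior derivative of a form on vector fields: the coordinate-free formula. -/
theorem extD_apply_vfield {k : ℕ} {φ : DiffForm n M (k + 1)} {U : Set M} (hφ : IsSmoothFormOn φ U)
    (hU : IsOpen U) {x : M} (hx : x ∈ U) {X : Fin (k + 2) → VField n M}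
    (hX : ∀ i, DiffVFieldAt (X i) x) :
    extD φ x (fun i ↦ X i x) =
      (∑ i : Fin (k + 2), (-1) ^ i.val •
        mvfderiv (𝓡 n) (fun y ↦ φ y (fun j ↦ X (i.succAbove j) y)) x (X i x)) -
      ∑ i : Fin (k + 1), ∑ j ≥ i, (-1) ^ (i + j : ℕ) •
        φ x (Matrix.vecCons (VectorField.mlieBracket (𝓡 n) (X i.castSucc) (X j.succ) x)
          (fun l ↦ X (i.castSucc.succAbove (j.succAbove l)) x)) := by
  have hxs := mem_chart_source (EuclideanSpace ℝ (Fin n)) x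
  have hxe := mem_extChartAt_source (I := 𝓡 n) x
  set p := extChartAt (𝓡 n) x x with hp
  set V : Fin (k + 2) → EuclideanSpace ℝ (Fin n) → EuclideanSpace ℝ (Fin n) :=
    fun i z ↦ vfieldRep x (X i) ((extChartAt (𝓡 n) x).symm z) with hV
  have hVp : ∀ i, V i p = vfieldRep x (X i) x := fun i ↦ by
    rw [hV, hp]
    exact congrArg (vfieldRep x (X i)) ((extChartAt (𝓡 n) x).left_inv hxe)
  have hVd : ∀ i, DifferentiableAt ℝ (V i) p := fun i ↦ by
    rw [← mdifferentiableAt_iff_differentiableAt]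
    have h1 := (hX i).vfieldRep hxs
    have h2 : MDifferentiableAt (𝓡 n) 𝓘(ℝ, EuclideanSpace ℝ (Fin n)) (GenGeom.vfieldRep x (X i))
        ((extChartAt (𝓡 n) x).symm p) := by
      rw [hp, (extChartAt (𝓡 n) x).left_inv hxe]; exact h1
    exact h2.comp p (((contMDiffOn_extChartAt_symm (n := ∞) x).contMDiffAt
      (extChartAt_target_mem_nhds x)).mdifferentiableAt (by simp))
  have hφd : DifferentiableAt ℝ (chartRep φ x) p :=
    (hφ.contDiffAt hU hx hxs).differentiableAt (by simp)
  have main := extDeriv_apply_vectorField hφd hVd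
  have hlhs : extD φ x (fun i ↦ X i x) = extDeriv (chartRep φ x) p (V · p) := by
    simp only [hVp]
    rfl
  rw [hlhs, main]
  congr 1
  · refine Finset.sum_congr rfl fun i _ ↦ ?_
    congr 1
    have hF : DifferentiableAt ℝ (fun z ↦ chartRep φ x z (i.removeNth (V · z))) p :=
      (hφd.hasFDerivAt.continuousAlternatingMap_apply
        (fun j ↦ (hVd (i.succAbove j)).hasFDerivAt)).differentiableAt
    have hev : (fun y ↦ φ y (fun j ↦ X (i.succAbove j) y)) =ᶠ[𝓝 x]
        fun y ↦ chartRep φ x (extChartAt (𝓡 n) x y) (i.removeNth (V · (extChartAt (𝓡 n) x y))) := by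
      filter_upwards [apply_vfield_eventuallyEq φ (fun j ↦ X (i.succAbove j)) hxs,
        (chartAt _ x).open_source.mem_nhds hxs] with y hy hys
      rw [hy]
      congr 1
      funext j
      exact (congrArg (vfieldRep x (X (i.succAbove j)))
        ((extChartAt (𝓡 n) x).left_inv (by simpa using hys))).symm
    have h := hasMFDerivAt_of_eventuallyEq_chart hev hF
    rw [mvfderiv, h.mfderiv, hVp]
    rfl
  · refine Finset.sum_congr rfl fun i _ ↦ Finset.sum_congr rfl fun j _ ↦ ?_
    congr 1
    refine Eq.trans ?_ (chartRep_apply_mfderiv φ hxe _)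
    congr 1
    funext l
    refine Fin.cases ?_ (fun l ↦ ?_) l
    · exact (mlieBracket_rep _ _ x).symm
    · exact hVp _

/-- The exterior derivative of a one-form on two vector fields. -/
theorem extD_one_apply {φ : DiffForm n M 1} {U : Set M} (hφ : IsSmoothFormOn φ U)
    (hU : IsOpen U) {x : M} (hx : x ∈ U) {X Y : VField n M}
    (hX : DiffVFieldAt X x) (hY : DiffVFieldAt Y x) :
    extD φ x ![X x, Y x] = mvfderiv (𝓡 n) (fun y ↦ φ y ![Y y]) x (X x)
      - mvfderiv (𝓡 n) (fun y ↦ φ y ![X y]) x (Y x)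
      - φ x ![VectorField.mlieBracket (𝓡 n) X Y x] := by
  have h := extD_apply_vfield hφ hU hx (X := ![X, Y]) (by
    intro i; fin_cases i <;> assumption)
  have e1 : (fun i ↦ (![X, Y] : Fin 2 → VField n M) i x) = ![X x, Y x] := by
    funext i; fin_cases i <;> rfl
  have e2 : ∀ y, (fun j : Fin 1 ↦ (![X, Y] : Fin 2 → VField n M) ((0 : Fin 2).succAbove j) y)
      = ![Y y] := fun y ↦ by funext j; fin_cases j; rfl
  have e3 : ∀ y, (fun j : Fin 1 ↦ (![X, Y] : Fin 2 → VField n M) ((1 : Fin 2).succAbove j) y)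
      = ![X y] := fun y ↦ by funext j; fin_cases j; rfl
  rw [e1, Fin.sum_univ_two] at h
  simp only [e2, e3] at h
  rw [h, Fin.sum_univ_one]
  rw [show Finset.Ici (0 : Fin 1) = {0} from rfl, Finset.sum_singleton]
  have e4 : ∀ a : TangentSpace (𝓡 n) x, ∀ f : Fin 0 → TangentSpace (𝓡 n) x,
      Matrix.vecCons a f = ![a] := fun a f ↦ by rw [Subsingleton.elim f ![]]
  rw [e4]
  simp only [Fin.val_zero, Fin.val_one, add_zero, pow_zero, pow_one, one_smul, neg_smul,
    ← sub_eq_add_neg]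
  rfl

/-- The exterior derivative of a two-form on three vector fields. -/
theorem extD_two_apply {φ : DiffForm n M 2} {U : Set M} (hφ : IsSmoothFormOn φ U)
    (hU : IsOpen U) {x : M} (hx : x ∈ U) {X Y Z : VField n M}
    (hX : DiffVFieldAt X x) (hY : DiffVFieldAt Y x) (hZ : DiffVFieldAt Z x) :
    extD φ x ![X x, Y x, Z x] = mvfderiv (𝓡 n) (fun y ↦ φ y ![Y y, Z y]) x (X x)
      - mvfderiv (𝓡 n) (fun y ↦ φ y ![X y, Z y]) x (Y x)
      + mvfderiv (𝓡 n) (fun y ↦ φ y ![X y, Y y]) x (Z x)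
      - φ x ![VectorField.mlieBracket (𝓡 n) X Y x, Z x]
      + φ x ![VectorField.mlieBracket (𝓡 n) X Z x, Y x]
      - φ x ![VectorField.mlieBracket (𝓡 n) Y Z x, X x] := by
  have h := extD_apply_vfield hφ hU hx (X := ![X, Y, Z]) (by
    intro i; fin_cases i <;> assumption)
  have e1 : (fun i ↦ (![X, Y, Z] : Fin 3 → VField n M) i x) = ![X x, Y x, Z x] := by
    funext i; fin_cases i <;> rfl
  have e2 : ∀ y, (fun j : Fin 2 ↦ (![X, Y, Z] : Fin 3 → VField n M) ((0 : Fin 3).succAbove j) y)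
      = ![Y y, Z y] := fun y ↦ by funext j; fin_cases j <;> rfl
  have e3 : ∀ y, (fun j : Fin 2 ↦ (![X, Y, Z] : Fin 3 → VField n M) ((1 : Fin 3).succAbove j) y)
      = ![X y, Z y] := fun y ↦ by funext j; fin_cases j <;> rfl
  have e4 : ∀ y, (fun j : Fin 2 ↦ (![X, Y, Z] : Fin 3 → VField n M) ((2 : Fin 3).succAbove j) y)
      = ![X y, Y y] := fun y ↦ by funext j; fin_cases j <;> rfl
  have e5 : (fun l : Fin 1 ↦ (![X, Y, Z] : Fin 3 → VField n M)
      ((Fin.castSucc (0 : Fin 2)).succAbove ((0 : Fin 2).succAbove l)) x) = ![Z x] := by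
    funext j; fin_cases j; rfl
  have e6 : (fun l : Fin 1 ↦ (![X, Y, Z] : Fin 3 → VField n M)
      ((Fin.castSucc (0 : Fin 2)).succAbove ((1 : Fin 2).succAbove l)) x) = ![Y x] := by
    funext j; fin_cases j; rfl
  have e7 : (fun l : Fin 1 ↦ (![X, Y, Z] : Fin 3 → VField n M)
      ((Fin.castSucc (1 : Fin 2)).succAbove ((1 : Fin 2).succAbove l)) x) = ![X x] := by
    funext j; fin_cases j; rfl
  rw [e1, Fin.sum_univ_three] at h
  simp only [e2, e3, e4] at h
  rw [h, Fin.sum_univ_two, show Finset.Ici (0 : Fin 2) = {0, 1} from rfl,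
    show Finset.Ici (1 : Fin 2) = {1} from rfl, Finset.sum_singleton,
    Finset.sum_pair (by decide), e5, e6, e7]
  simp only [Fin.val_zero, Fin.val_one, Fin.val_two, add_zero, zero_add, one_add_one_eq_two,
    neg_one_sq, pow_zero, pow_one, one_smul, neg_smul]
  change _ + -_ + _ - (φ x ![VectorField.mlieBracket (𝓡 n) X Y x, Z x]
    + -φ x ![VectorField.mlieBracket (𝓡 n) X Z x, Y x]
    + φ x ![VectorField.mlieBracket (𝓡 n) Y Z x, X x]) = _
  simp only [Matrix.cons_val]
  ring

/-- The exterior derivative of a function. -/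
theorem extD_zero_apply {φ : DiffForm n M 0} {x : M}
    (hφ : MDifferentiableAt (𝓡 n) 𝓘(ℝ) (fun y ↦ φ y ![]) x) (v : TangentSpace (𝓡 n) x) :
    extD φ x ![v] = mvfderiv (𝓡 n) (fun y ↦ φ y ![]) x v := by
  have hxe := mem_extChartAt_source (I := 𝓡 n) x
  set F : EuclideanSpace ℝ (Fin n) → ℝ := fun z ↦ φ ((extChartAt (𝓡 n) x).symm z) ![] with hF
  have hrep : chartRep φ x = fun z ↦ ContinuousAlternatingMap.constOfIsEmpty ℝ
      (EuclideanSpace ℝ (Fin n)) (Fin 0) (F z) := by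
    funext z
    ext w
    exact congrArg (φ ((extChartAt (𝓡 n) x).symm z)) (Subsingleton.elim _ _)
  have hFd : DifferentiableAt ℝ F (extChartAt (𝓡 n) x x) := by
    rw [← mdifferentiableAt_iff_differentiableAt]
    have h2 : MDifferentiableAt (𝓡 n) 𝓘(ℝ) (fun y ↦ φ y ![])
        ((extChartAt (𝓡 n) x).symm (extChartAt (𝓡 n) x x)) := by
      rw [(extChartAt (𝓡 n) x).left_inv hxe]; exact hφ
    exact h2.comp _ (((contMDiffOn_extChartAt_symm (n := ∞) x).contMDiffAt
      (extChartAt_target_mem_nhds x)).mdifferentiableAt (by simp))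
  have hev : (fun y ↦ φ y ![]) =ᶠ[𝓝 x] fun y ↦ F (extChartAt (𝓡 n) x y) := by
    filter_upwards [(chartAt (EuclideanSpace ℝ (Fin n)) x).open_source.mem_nhds
      (mem_chart_source _ x)] with y hy
    have hs : y ∈ (extChartAt (𝓡 n) x).source := by simpa using hy
    have aux : ∀ y' : M, y' = y → φ y ![] = φ y' ![] := by rintro y' rfl; rfl
    exact aux _ ((extChartAt (𝓡 n) x).left_inv hs)
  rw [mvfderiv, (hasMFDerivAt_of_eventuallyEq_chart hev hFd).mfderiv, extD, hrep,
    extDeriv_constOfIsEmpty]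
  rfl

/-- A function as a differential form of degree zero. -/
def formOfFunction (f : M → ℝ) : DiffForm n M 0 := fun x ↦
  ContinuousAlternatingMap.constOfIsEmpty ℝ (EuclideanSpace ℝ (Fin n)) (Fin 0) (f x)

theorem extD_formOfFunction {f : M → ℝ} {x : M} (hf : MDifferentiableAt (𝓡 n) 𝓘(ℝ) f x)
    (v : TangentSpace (𝓡 n) x) : extD (formOfFunction f) x ![v] = mvfderiv (𝓡 n) f x v :=
  extD_zero_apply hf v

/-- The derivative of a smooth function along a smooth vector field is smooth: it is the value of the
smooth one-form `df`. -/
theorem contMDiffAt_mvfderiv_apply {f : M → ℝ} {U : Set M} (hU : IsOpen U) {x : M} (hx : x ∈ U)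
    (hf : ∀ y ∈ U, ContMDiffAt (𝓡 n) 𝓘(ℝ) ∞ f y) {X : VField n M} (hX : SmoothVFieldAt X x) :
    ContMDiffAt (𝓡 n) 𝓘(ℝ) ∞ (fun y ↦ mvfderiv (𝓡 n) f y (X y)) x := by
  have h : IsSmoothFormOn (formOfFunction (n := n) f) U :=
    isSmoothFormOn_of_apply fun y hy _ _ ↦ hf y hy
  refine ((h.extD hU).apply_one hU hx hX).congr_of_eventuallyEq ?_
  filter_upwards [hU.mem_nhds hx] with y hy
  exact (extD_formOfFunction ((hf y hy).mdifferentiableAt (by simp)) _).symm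

theorem SmoothVFieldAt.mlieBracket {X Y : VField n M} {x : M} (hX : SmoothVFieldAt X x)
    (hY : SmoothVFieldAt Y x) : SmoothVFieldAt (mlieBracket (𝓡 n) X Y) x := by
  have : IsManifold (𝓡 n) (minSmoothness ℝ 2) M := .of_le two_le_infty
  have : IsManifold (𝓡 n) (((⊤ : ℕ∞) : ℕ∞ω) + 1) M := by simpa using ‹IsManifold (𝓡 n) ∞ M›
  exact ContMDiffAt.mlieBracket_vectorField (m := ⊤) (n := ⊤) hX hY (by simp)

/-! ### Algebra of forms of low degree -/

section Algebra

variable {x : M}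

/-- The value of a one-form as a linear functional. -/
def functionalOf (x : M) : FormAt n x 1 →ₗ[ℝ] (TangentSpace (𝓡 n) x →ₗ[ℝ] ℝ) where
  toFun ξ :=
    { toFun := fun v ↦ ξ ![v]
      map_add' := oneForm_add ξ
      map_smul' := oneForm_smul ξ }
  map_add' _ _ := rfl
  map_smul' _ _ := rfl

theorem twoForm_swap (φ : FormAt n x 2) (a b : TangentSpace (𝓡 n) x) :
    φ ![b, a] = -φ ![a, b] := by
  have h := φ.toAlternatingMap.map_swap ![a, b] (show (0 : Fin 2) ≠ 1 by decide)
  have h2 : (![a, b] ∘ Equiv.swap (0 : Fin 2) 1) = ![b, a] := by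
    funext i; fin_cases i <;> rfl
  rw [h2] at h
  exact h

section ThreeForms

variable (τ : FormAt n x 3)

theorem threeForm_add_left (a a' b c : TangentSpace (𝓡 n) x) :
    τ ![a + a', b, c] = τ ![a, b, c] + τ ![a', b, c] := τ.map_vecCons_add ![b, c] a a'

theorem threeForm_smul_left (r : ℝ) (a b c : TangentSpace (𝓡 n) x) :
    τ ![r • a, b, c] = r * τ ![a, b, c] := τ.map_vecCons_smul ![b, c] r a

theorem threeForm_add_middle (a b b' c : TangentSpace (𝓡 n) x) :
    τ ![a, b + b', c] = τ ![a, b, c] + τ ![a, b', c] :=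
  (interior a τ).map_vecCons_add ![c] b b'

theorem threeForm_smul_middle (r : ℝ) (a b c : TangentSpace (𝓡 n) x) :
    τ ![a, r • b, c] = r * τ ![a, b, c] := (interior a τ).map_vecCons_smul ![c] r b

theorem threeForm_add_right (a b c c' : TangentSpace (𝓡 n) x) :
    τ ![a, b, c + c'] = τ ![a, b, c] + τ ![a, b, c'] :=
  oneForm_add (interior b (interior a τ)) c c'

theorem threeForm_smul_right (r : ℝ) (a b c : TangentSpace (𝓡 n) x) :
    τ ![a, b, r • c] = r * τ ![a, b, c] := oneForm_smul (interior b (interior a τ)) r c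

theorem threeForm_swap_left (a b c : TangentSpace (𝓡 n) x) : τ ![b, a, c] = -τ ![a, b, c] := by
  have h := τ.toAlternatingMap.map_swap ![a, b, c] (show (0 : Fin 3) ≠ 1 by decide)
  have h2 : (![a, b, c] ∘ Equiv.swap (0 : Fin 3) 1) = ![b, a, c] := by
    funext i; fin_cases i <;> rfl
  rw [h2] at h
  exact h

theorem threeForm_swap_right (a b c : TangentSpace (𝓡 n) x) : τ ![a, c, b] = -τ ![a, b, c] := by
  have h := τ.toAlternatingMap.map_swap ![a, b, c] (show (1 : Fin 3) ≠ 2 by decide)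
  have h2 : (![a, b, c] ∘ Equiv.swap (1 : Fin 3) 2) = ![a, c, b] := by
    funext i; fin_cases i <;> rfl
  rw [h2] at h
  exact h

end ThreeForms

end Algebra

/-! ### Derivatives of functions -/

section Derivatives

variable {x : M}

theorem mvfderiv_add_apply {f g : M → ℝ} (hf : MDifferentiableAt (𝓡 n) 𝓘(ℝ) f x)
    (hg : MDifferentiableAt (𝓡 n) 𝓘(ℝ) g x) (v : TangentSpace (𝓡 n) x) :
    mvfderiv (𝓡 n) (fun y ↦ f y + g y) x v = mvfderiv (𝓡 n) f x v + mvfderiv (𝓡 n) g x v := by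
  rw [mvfderiv_fun_add hf hg]; rfl

theorem mvfderiv_sub_apply {f g : M → ℝ} (hf : MDifferentiableAt (𝓡 n) 𝓘(ℝ) f x)
    (hg : MDifferentiableAt (𝓡 n) 𝓘(ℝ) g x) (v : TangentSpace (𝓡 n) x) :
    mvfderiv (𝓡 n) (fun y ↦ f y - g y) x v = mvfderiv (𝓡 n) f x v - mvfderiv (𝓡 n) g x v := by
  rw [mvfderiv_fun_sub hf hg]; rfl

theorem mvfderiv_mul_apply {f g : M → ℝ} (hf : MDifferentiableAt (𝓡 n) 𝓘(ℝ) f x)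
    (hg : MDifferentiableAt (𝓡 n) 𝓘(ℝ) g x) (v : TangentSpace (𝓡 n) x) :
    mvfderiv (𝓡 n) (fun y ↦ f y * g y) x v =
      f x * mvfderiv (𝓡 n) g x v + g x * mvfderiv (𝓡 n) f x v := by
  rw [mvfderiv_fun_mul hf hg]; rfl

theorem mvfderiv_congr_apply {f g : M → ℝ} (h : f =ᶠ[𝓝 x] g) (v : TangentSpace (𝓡 n) x) :
    mvfderiv (𝓡 n) f x v = mvfderiv (𝓡 n) g x v :=
  DFunLike.congr_fun (h.mfderiv_eq (I := 𝓡 n) (I' := 𝓘(ℝ))) v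

end Derivatives

/-! ### The Courant bracket on `T ⊕ T*` -/

/-- Cartan's formula for the one-form part of the Courant bracket. -/
theorem courantForm_apply {ξ η : DiffForm n M 1} {U : Set M} (hξ : IsSmoothFormOn ξ U)
    (hη : IsSmoothFormOn η U) (hU : IsOpen U) {x : M} (hx : x ∈ U) {X Y Z : VField n M}
    (hX : SmoothVFieldAt X x) (hY : SmoothVFieldAt Y x) (hZ : SmoothVFieldAt Z x) :
    courantForm X ξ Y η x ![Z x] =
      mvfderiv (𝓡 n) (fun y ↦ η y ![Z y]) x (X x) - η x ![mlieBracket (𝓡 n) X Z x]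
      - mvfderiv (𝓡 n) (fun y ↦ ξ y ![Z y]) x (Y x) + ξ x ![mlieBracket (𝓡 n) Y Z x]
      - 1 / 2 * (mvfderiv (𝓡 n) (fun y ↦ η y ![X y]) x (Z x)
        - mvfderiv (𝓡 n) (fun y ↦ ξ y ![Y y]) x (Z x)) := by
  have d1 : MDifferentiableAt (𝓡 n) 𝓘(ℝ) (fun y ↦ η y ![X y]) x :=
    (hη.apply_one hU hx hX).mdifferentiableAt (by simp)
  have d2 : MDifferentiableAt (𝓡 n) 𝓘(ℝ) (fun y ↦ ξ y ![Y y]) x :=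
    (hξ.apply_one hU hx hY).mdifferentiableAt (by simp)
  have e1 : extD (fun y ↦ interior (X y) (η y)) x ![Z x] =
      mvfderiv (𝓡 n) (fun y ↦ η y ![X y]) x (Z x) := extD_zero_apply d1 _
  have e2 : extD (fun y ↦ interior (Y y) (ξ y)) x ![Z x] =
      mvfderiv (𝓡 n) (fun y ↦ ξ y ![Y y]) x (Z x) := extD_zero_apply d2 _
  have e3 : extD (fun y ↦ interior (X y) (η y) - interior (Y y) (ξ y)) x ![Z x] =
      mvfderiv (𝓡 n) (fun y ↦ η y ![X y]) x (Z x) - mvfderiv (𝓡 n) (fun y ↦ ξ y ![Y y]) x (Z x) :=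
    (extD_zero_apply (d1.sub d2) _).trans (by rw [← mvfderiv_sub_apply d1 d2]; rfl)
  have e4 := extD_one_apply hη hU hx hX.diff hZ.diff
  have e5 := extD_one_apply hξ hU hx hY.diff hZ.diff
  change extD η x ![X x, Z x] + extD (fun y ↦ interior (X y) (η y)) x ![Z x]
    - (extD ξ x ![Y x, Z x] + extD (fun y ↦ interior (Y y) (ξ y)) x ![Z x])
    - 1 / 2 * extD (fun y ↦ interior (X y) (η y) - interior (Y y) (ξ y)) x ![Z x] = _
  rw [e1, e2, e3, e4, e5]
  ring

/-! ### Smooth bundle maps out of the tangent bundle -/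

theorem symmL_trivializationAt_eq_coordField {x₀ y : M}
    (hy : y ∈ (chartAt (EuclideanSpace ℝ (Fin n)) x₀).source) (v : EuclideanSpace ℝ (Fin n)) :
    (trivializationAt (EuclideanSpace ℝ (Fin n)) (TangentSpace (𝓡 n)) x₀).symmL ℝ y v =
      coordField x₀ v y := by
  have h := TangentBundle.symmL_trivializationAt (I := 𝓡 n) hy
  refine (DFunLike.congr_fun h v).trans ?_
  rw [ModelWithCorners.range_eq_univ, mfderivWithin_univ]
  rfl

/-- A bundle map out of the tangent bundle is smooth at `x₀` if its values on the coordinate vector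
fields at `x₀` are. -/
theorem contMDiffAt_hom_of_apply {F : Type*} [NormedAddCommGroup F] [NormedSpace ℝ F]
    {E : M → Type*} [TopologicalSpace (TotalSpace F E)] [∀ x, AddCommGroup (E x)]
    [∀ x, Module ℝ (E x)] [∀ x, TopologicalSpace (E x)] [FiberBundle F E] [VectorBundle ℝ F E]
    [∀ x, IsTopologicalAddGroup (E x)] [∀ x, ContinuousSMul ℝ (E x)]
    {L : ∀ x : M, TangentSpace (𝓡 n) x →L[ℝ] E x} {x₀ : M}
    (h : ∀ v : EuclideanSpace ℝ (Fin n), ContMDiffAt (𝓡 n) ((𝓡 n).prod 𝓘(ℝ, F)) ∞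
      (fun y ↦ TotalSpace.mk' F y (L y (coordField x₀ v y))) x₀) :
    ContMDiffAt (𝓡 n) ((𝓡 n).prod 𝓘(ℝ, EuclideanSpace ℝ (Fin n) →L[ℝ] F)) ∞
      (fun y ↦ TotalSpace.mk' (EuclideanSpace ℝ (Fin n) →L[ℝ] F)
        (E := fun x ↦ TangentSpace (𝓡 n) x →L[ℝ] E x) y (L y)) x₀ := by
  refine (contMDiffAt_hom_bundle _).2 ⟨contMDiffAt_id, contMDiffAt_clm_of_apply fun v ↦ ?_⟩
  refine (contMDiffAt_totalSpace.1 (h v)).2.congr_of_eventuallyEq ?_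
  filter_upwards [(chartAt (EuclideanSpace ℝ (Fin n)) x₀).open_source.mem_nhds
    (mem_chart_source _ x₀), (trivializationAt F E x₀).open_baseSet.mem_nhds
    (FiberBundle.mem_baseSet_trivializationAt' x₀)] with y hy hy'
  have h1 : ContinuousLinearMap.inCoordinates (EuclideanSpace ℝ (Fin n)) (TangentSpace (𝓡 n)) F E
      x₀ y x₀ y (L y) v = (trivializationAt F E x₀).continuousLinearMapAt ℝ y
        (L y ((trivializationAt (EuclideanSpace ℝ (Fin n)) (TangentSpace (𝓡 n)) x₀).symmL ℝ y v)) :=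
    rfl
  refine h1.trans ?_
  rw [symmL_trivializationAt_eq_coordField hy]
  exact congrFun (Trivialization.coe_linearMapAt_of_mem (R := ℝ) _ hy') _

/-- The case of the trivial line bundle: a one-form is smooth at `x₀` if its values on the coordinate
vector fields at `x₀` are. -/
theorem contMDiffAt_hom_of_apply_real {L : ∀ x : M, TangentSpace (𝓡 n) x →L[ℝ] ℝ} {x₀ : M}
    (h : ∀ v : EuclideanSpace ℝ (Fin n), ContMDiffAt (𝓡 n) 𝓘(ℝ) ∞
      (fun y ↦ L y (coordField x₀ v y)) x₀) :
    ContMDiffAt (𝓡 n) ((𝓡 n).prod 𝓘(ℝ, EuclideanSpace ℝ (Fin n) →L[ℝ] ℝ)) ∞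
      (fun y ↦ TotalSpace.mk' (EuclideanSpace ℝ (Fin n) →L[ℝ] ℝ)
        (E := fun x ↦ TangentSpace (𝓡 n) x →L[ℝ] ℝ) y (L y)) x₀ := by
  refine contMDiffAt_hom_of_apply (E := Trivial M ℝ) fun v ↦ ?_
  exact (contMDiffAt_section x₀).2 (h v)

end Forms

/-- The unit ball of a positive definite form on a finite-dimensional space is bounded. -/
theorem isBounded_of_posDef {F : Type*} [NormedAddCommGroup F] [NormedSpace ℝ F]
    [FiniteDimensional ℝ F] (b : F →L[ℝ] F →L[ℝ] ℝ) (hb : ∀ v, v ≠ 0 → 0 < b v v) :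
    Bornology.IsBounded {v : F | b v v < 1} := by
  have hcont : Continuous fun v ↦ b v v := by fun_prop
  obtain ⟨c, hc, hcb⟩ : ∃ c > 0, ∀ v ∈ Metric.sphere (0 : F) 1, c ≤ b v v := by
    rcases (Metric.sphere (0 : F) 1).eq_empty_or_nonempty with he | hne
    · exact ⟨1, one_pos, by simp [he]⟩
    · obtain ⟨v, hv, hmin⟩ := (isCompact_sphere (0 : F) 1).exists_isMinOn hne hcont.continuousOn
      exact ⟨b v v, hb v (by rintro rfl; simp at hv), fun w hw ↦ hmin hw⟩
  refine isBounded_iff_forall_norm_le.2 ⟨√(1 / c), fun v hv ↦ ?_⟩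
  refine Real.le_sqrt_of_sq_le ?_
  rw [le_div_iff₀ hc]
  rcases eq_or_ne v 0 with rfl | hv0
  · simp
  have hn : 0 < ‖v‖ := norm_pos_iff.2 hv0
  have h := hcb (‖v‖⁻¹ • v) (by simp [norm_smul, hn.ne'])
  simp only [map_smul, smul_apply, smul_eq_mul] at h
  have h' : c * ‖v‖ ^ 2 ≤ b v v := by
    calc c * ‖v‖ ^ 2 ≤ (‖v‖⁻¹ * (‖v‖⁻¹ * b v v)) * ‖v‖ ^ 2 := by gcongr
      _ = b v v := by field_simp
  have hv : b v v < 1 := hv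
  linarith

namespace ConnectiveGerbe

variable {n : ℕ} {M : Type*} [TopologicalSpace M] [ChartedSpace (EuclideanSpace ℝ (Fin n)) M]
  {ι : Type*} {𝒢 : ConnectiveGerbe n M ι}

theorem repForm_apply (u : ∀ x, 𝒢.Fibre x) {α : ι} {x : M} (hx : x ∈ 𝒢.U α) :
    𝒢.repForm u α x = 𝒢.rep ⟨α, hx⟩ (u x) := dif_pos hx

namespace GeneralizedMetric

variable [IsManifold (𝓡 n) ∞ M] (V : 𝒢.GeneralizedMetric)

/-! ### The lifts to `V` and its orthogonal complement, and the curving -/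

/-- The lift to `V` of a smooth vector field is locally a combination of the sections of a smooth
frame of `V`, with smooth coefficients. -/
theorem exists_plus_eq_sum {X : VField n M} {x : M} (hX : SmoothVFieldAt X x) :
    ∃ W : Set M, IsOpen W ∧ x ∈ W ∧ ∃ s : Fin n → ∀ y, 𝒢.Fibre y,
      (∀ i, 𝒢.IsSmoothSectionOn (s i) W) ∧ ∃ c : M → EuclideanSpace ℝ (Fin n),
        ContMDiffAt (𝓡 n) 𝓘(ℝ, EuclideanSpace ℝ (Fin n)) ∞ c x ∧
        ∀ᶠ y in 𝓝 x, V.plus y (X y) = ∑ i, c y i • s i y := by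
  obtain ⟨W, hW, hxW, s, hs, hspan⟩ := V.smooth x
  refine ⟨W, hW, hxW, s, hs, ?_⟩
  have hxs := mem_chart_source (EuclideanSpace ℝ (Fin n)) x
  let p : Fin n → VField n M := fun i y ↦ 𝒢.proj y (s i y)
  let P : M → EuclideanSpace ℝ (Fin n) →L[ℝ] EuclideanSpace ℝ (Fin n) := fun y ↦
    ∑ i, (EuclideanSpace.proj i : EuclideanSpace ℝ (Fin n) →L[ℝ] ℝ).smulRight
      (vfieldRep x (p i) y)
  have hPapp : ∀ y e, P y e = ∑ i, e i • vfieldRep x (p i) y := fun y e ↦ by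
    simp [P]
  have hPsm : ContMDiffAt (𝓡 n)
      𝓘(ℝ, EuclideanSpace ℝ (Fin n) →L[ℝ] EuclideanSpace ℝ (Fin n)) ∞ P x := by
    refine contMDiffAt_clm_of_apply fun e ↦ ?_
    simp only [hPapp]
    refine ContMDiffAt.sum fun i _ ↦ ?_
    have h := (smoothVFieldAt_iff_vfieldRep hxs).1 ((hs i).proj.contMDiffAt (hW.mem_nhds hxW))
    exact (contMDiffAt_const (c := (e i : ℝ)) (I' := 𝓘(ℝ))).smul h
  -- the projections of the frame span each tangent space
  have hlift : ∀ y ∈ W, ∀ w : TangentSpace (𝓡 n) y, ∃ e : EuclideanSpace ℝ (Fin n),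
      V.plus y w = ∑ i, e i • s i y ∧
      (mfderiv (𝓡 n) 𝓘(ℝ, EuclideanSpace ℝ (Fin n)) (extChartAt (𝓡 n) x) y w :
        EuclideanSpace ℝ (Fin n)) = P y e := fun y hy w ↦ by
    have h := V.plus_mem y w
    rw [hspan y hy, Submodule.mem_span_range_iff_exists_fun] at h
    obtain ⟨e, he⟩ := h
    refine ⟨WithLp.toLp 2 e, he.symm, ?_⟩
    have hw : w = ∑ i, e i • 𝒢.proj y (s i y) := by
      rw [← V.proj_plus y w, ← he, map_sum]
      exact Finset.sum_congr rfl fun i _ ↦ map_smul _ _ _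
    have hw' : mfderiv (𝓡 n) 𝓘(ℝ, EuclideanSpace ℝ (Fin n)) (extChartAt (𝓡 n) x) y w =
        ∑ i, mfderiv (𝓡 n) 𝓘(ℝ, EuclideanSpace ℝ (Fin n)) (extChartAt (𝓡 n) x) y
          (e i • 𝒢.proj y (s i y)) := (congrArg _ hw).trans (map_sum _ _ _)
    refine hw'.trans ((Finset.sum_congr rfl fun i _ ↦ ?_).trans (hPapp y _).symm)
    exact map_smul _ _ _
  -- hence `P y`, being a surjective endomorphism, is invertible
  have hinj : ∀ y ∈ W, y ∈ (chartAt (EuclideanSpace ℝ (Fin n)) x).source →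
      ∃ Q : EuclideanSpace ℝ (Fin n) ≃L[ℝ] EuclideanSpace ℝ (Fin n), P y = Q := by
    intro y hy hys
    have hsurj : Function.Surjective
        (P y : EuclideanSpace ℝ (Fin n) →ₗ[ℝ] EuclideanSpace ℝ (Fin n)) := fun v ↦ by
      obtain ⟨e, -, he⟩ := hlift y hy (coordField x v y)
      exact ⟨e, he.symm.trans (mfderiv_mfderiv_symm_extChartAt (by simpa using hys) v)⟩
    exact ⟨(LinearEquiv.ofBijective _ ⟨LinearMap.injective_iff_surjective.2 hsurj,
      hsurj⟩).toContinuousLinearEquiv, rfl⟩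
  -- the coefficients of `X` in the projected frame
  refine ⟨fun y ↦ (P y).inverse (vfieldRep x X y), ?_, ?_⟩
  · obtain ⟨Q, hQ⟩ := hinj x hxW hxs
    have hinv : ContMDiffAt 𝓘(ℝ, EuclideanSpace ℝ (Fin n) →L[ℝ] EuclideanSpace ℝ (Fin n))
        𝓘(ℝ, EuclideanSpace ℝ (Fin n) →L[ℝ] EuclideanSpace ℝ (Fin n)) ∞
        ContinuousLinearMap.inverse (P x) := by
      rw [hQ]; exact (contDiffAt_map_inverse Q).contMDiffAt
    exact (hinv.comp x hPsm).clm_apply ((smoothVFieldAt_iff_vfieldRep hxs).1 hX)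
  · filter_upwards [hW.mem_nhds hxW,
      (chartAt (EuclideanSpace ℝ (Fin n)) x).open_source.mem_nhds hxs] with y hy hys
    obtain ⟨e, he, he'⟩ := hlift y hy (X y)
    obtain ⟨Q, hQ⟩ := hinj y hy hys
    have : (P y).inverse (vfieldRep x X y) = e := by
      refine (congrArg _ he').trans ?_
      rw [hQ, ContinuousLinearMap.inverse_equiv]
      exact Q.symm_apply_apply e
    rw [this, he]

/-- The lifts to `V` of smooth vector fields are smooth in every trivialization of `E`. -/
theorem contMDiffAt_rep_plus {X Y : VField n M} {α : ι} {x : M} (hx : x ∈ 𝒢.U α)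
    (hX : SmoothVFieldAt X x) (hY : SmoothVFieldAt Y x) :
    ContMDiffAt (𝓡 n) 𝓘(ℝ) ∞
      (fun y ↦ 𝒢.repForm (fun z ↦ V.plus z (X z)) α y ![Y y]) x := by
  obtain ⟨W, hW, hxW, s, hs, c, hc, heq⟩ := V.exists_plus_eq_sum hX
  have h : ContMDiffAt (𝓡 n) 𝓘(ℝ) ∞
      (fun y ↦ ∑ i, c y i * 𝒢.repForm (s i) α y ![Y y]) x := by
    refine ContMDiffAt.sum fun i _ ↦ ContMDiffAt.mul ?_ ?_
    · exact (EuclideanSpace.proj i : EuclideanSpace ℝ (Fin n) →L[ℝ] ℝ).contMDiff.contMDiffAt.comp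
        x hc
    · exact ((hs i).rep α).apply_one ((𝒢.isOpen_U α).inter hW) ⟨hx, hxW⟩ hY
  refine h.congr_of_eventuallyEq ?_
  filter_upwards [heq, (𝒢.isOpen_U α).mem_nhds hx] with y hy hyα
  rw [repForm_apply _ hyα, hy, map_sum, ContinuousAlternatingMap.sum_apply]
  refine Finset.sum_congr rfl fun i _ ↦ ?_
  rw [repForm_apply _ hyα, map_smul]
  rfl

theorem contMDiffAt_metric {X Y : VField n M} {x : M}
    (hX : SmoothVFieldAt X x) (hY : SmoothVFieldAt Y x) :
    ContMDiffAt (𝓡 n) 𝓘(ℝ) ∞ (fun y ↦ V.metric y (X y) ![Y y]) x := by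
  obtain ⟨α, hα⟩ := 𝒢.cover x
  have h := contMDiffAt_const (c := (1 / 2 : ℝ)).mul
    ((V.contMDiffAt_rep_plus hα hX hY).add (V.contMDiffAt_rep_plus hα hY hX))
  refine h.congr_of_eventuallyEq ?_
  filter_upwards [(𝒢.isOpen_U α).mem_nhds hα] with y hyα
  rw [metric_apply, 𝒢.pairing_eq ⟨α, hyα⟩, proj_plus, proj_plus]
  simp only [Pi.add_apply, Pi.mul_apply, repForm_apply _ hyα]

theorem minus_eq (x : M) (v : TangentSpace (𝓡 n) x) :
    V.minus x v = V.plus x v + (-2 : ℝ) • 𝒢.ofCovector x (V.metric x v) := by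
  rw [ofCovector_metric]
  module

theorem rep_minus {x : M} (α : 𝒢.IndexAt x) (v w : TangentSpace (𝓡 n) x) :
    𝒢.rep α (V.minus x v) ![w] = 𝒢.rep α (V.plus x v) ![w] - 2 * V.metric x v ![w] := by
  rw [minus_eq, map_add, map_smul, rep_ofCovector]
  rw [ContinuousAlternatingMap.add_apply, ContinuousAlternatingMap.smul_apply, smul_eq_mul]
  ring

theorem rep_average {x : M} (α : 𝒢.IndexAt x) (v w : TangentSpace (𝓡 n) x) :
    𝒢.rep α (V.average x v) ![w] = 𝒢.rep α (V.plus x v) ![w] - V.metric x v ![w] := by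
  rw [average_eq, map_add, map_smul, rep_ofCovector]
  rw [ContinuousAlternatingMap.add_apply, ContinuousAlternatingMap.smul_apply, smul_eq_mul]
  ring

theorem metric_comm (x : M) (v w : TangentSpace (𝓡 n) x) :
    V.metric x v ![w] = V.metric x w ![v] := by
  rw [metric_apply, metric_apply, pairing_comm]

theorem curving_apply {α : ι} {x : M} (hx : x ∈ 𝒢.U α) : V.curving α x = V.curvingAt ⟨α, hx⟩ :=
  dif_pos hx

theorem curving_pair {α : ι} {x : M} (hx : x ∈ 𝒢.U α) (v w : TangentSpace (𝓡 n) x) :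
    V.curving α x ![v, w] = 𝒢.rep ⟨α, hx⟩ (V.average x v) ![w] := by
  rw [V.curving_apply hx, ← interior_curvingAt]
  rfl

/-- In the trivialization over `U α` one has `X⁺ = X + i_X (B α) + gX`. -/
theorem rep_plus_eq {α : ι} {x : M} (hx : x ∈ 𝒢.U α) (v w : TangentSpace (𝓡 n) x) :
    𝒢.rep ⟨α, hx⟩ (V.plus x v) ![w] = V.curving α x ![v, w] + V.metric x v ![w] := by
  rw [V.curving_pair hx, rep_average]
  ring

/-- In the trivialization over `U α` one has `X⁻ = X + i_X (B α) - gX`. -/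
theorem rep_minus_eq {α : ι} {x : M} (hx : x ∈ 𝒢.U α) (v w : TangentSpace (𝓡 n) x) :
    𝒢.rep ⟨α, hx⟩ (V.minus x v) ![w] = V.curving α x ![v, w] - V.metric x v ![w] := by
  rw [rep_minus, rep_plus_eq]
  ring

theorem isSmoothFormOn_curving (α : ι) : IsSmoothFormOn (V.curving α) (𝒢.U α) := by
  refine isSmoothFormOn_two_of_apply fun x hx X Y hX hY ↦ ?_
  refine ((V.contMDiffAt_rep_plus hx hX hY).sub (V.contMDiffAt_metric hX hY)).congr_of_eventuallyEq
    ?_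
  filter_upwards [(𝒢.isOpen_U α).mem_nhds hx] with y hyα
  rw [repForm_apply _ hyα, rep_plus_eq]
  ring

theorem isSmoothSectionOn_plus {X : VField n M} (hX : IsSmoothVFieldOn X Set.univ) :
    𝒢.IsSmoothSectionOn (fun x ↦ V.plus x (X x)) Set.univ where
  proj := by simpa only [proj_plus] using hX
  rep α := by
    rw [Set.inter_univ]
    exact isSmoothFormOn_one_of_apply fun x hx Y hY ↦
      V.contMDiffAt_rep_plus hx (hX.contMDiffAt Filter.univ_mem) hY

theorem isSmoothSectionOn_minus {X : VField n M} (hX : IsSmoothVFieldOn X Set.univ) :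
    𝒢.IsSmoothSectionOn (fun x ↦ V.minus x (X x)) Set.univ where
  proj := by simpa only [proj_minus] using hX
  rep α := by
    rw [Set.inter_univ]
    refine isSmoothFormOn_one_of_apply fun x hx Y hY ↦ ?_
    have hX' : SmoothVFieldAt X x := hX.contMDiffAt Filter.univ_mem
    refine ((V.contMDiffAt_rep_plus hx hX' hY).sub
      (contMDiffAt_const (c := (2 : ℝ)).mul (V.contMDiffAt_metric hX' hY))).congr_of_eventuallyEq ?_
    filter_upwards [(𝒢.isOpen_U α).mem_nhds hx] with y hyα
    rw [Pi.mul_apply, repForm_apply _ hyα, repForm_apply _ hyα, rep_minus]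

/-- The change of trivialization of `E`, applied to the average of the two splittings, is the
compatibility of the curvings. -/
theorem curving_sub_curving {α β : ι} {x : M} (hx : x ∈ 𝒢.U α ∩ 𝒢.U β) :
    V.curving β x - V.curving α x = extD (𝒢.A α β) x := by
  refine twoForm_ext fun v w ↦ ?_
  change V.curving β x ![v, w] - V.curving α x ![v, w] = _
  rw [V.curving_pair hx.1, V.curving_pair hx.2, 𝒢.rep_eq ⟨α, hx.1⟩ ⟨β, hx.2⟩, proj_average]
  exact add_sub_cancel_left _ _

theorem isCurving_curving : 𝒢.IsCurving V.curving :=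
  ⟨V.isSmoothFormOn_curving, fun _ _ _ hx ↦ V.curving_sub_curving hx⟩

/-- The exterior derivatives of the curvings agree: `dB_β - dB_α = ddA_{αβ} = 0`. -/
theorem extD_curving_eq {α β : ι} {x : M} (hx : x ∈ 𝒢.U α ∩ 𝒢.U β) :
    extD (V.curving β) x = extD (V.curving α) x := by
  have hxs := mem_chart_source (EuclideanSpace ℝ (Fin n)) x
  have hU := (𝒢.isOpen_U α).inter (𝒢.isOpen_U β)
  have hev : chartRep (V.curving β) x =ᶠ[𝓝 (extChartAt (𝓡 n) x x)]
      chartRep (V.curving α) x + chartRep (extD (𝒢.A α β)) x := by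
    filter_upwards [chartSet_mem_nhds hU hx hxs] with z hz
    have h := V.curving_sub_curving hz.2
    rw [sub_eq_iff_eq_add'] at h
    ext w
    exact DFunLike.congr_fun h _
  have hd : extD (extD (𝒢.A α β)) x = 0 := extD_extD (𝒢.smooth_A α β) hU hx
  have h1 : DifferentiableAt ℝ (chartRep (V.curving α) x) (extChartAt (𝓡 n) x x) :=
    ((V.isSmoothFormOn_curving α).contDiffAt (𝒢.isOpen_U α) hx.1 hxs).differentiableAt (by simp)
  have h2 : DifferentiableAt ℝ (chartRep (extD (𝒢.A α β)) x) (extChartAt (𝓡 n) x x) :=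
    (((𝒢.smooth_A α β).extD hU).contDiffAt hU hx hxs).differentiableAt (by simp)
  refine Eq.trans ?_ (add_zero (extD (V.curving α) x))
  rw [← hd]
  ext w
  have h := hev.extDeriv_eq.trans (extDeriv_add h1 h2)
  exact DFunLike.congr_fun h _

theorem extD_curving {α : ι} {x : M} (hx : x ∈ 𝒢.U α) : extD (V.curving α) x = V.curvature x :=
  V.extD_curving_eq ⟨(𝒢.indexAt x).2, hx⟩

theorem isSmoothFormOn_curvature : IsSmoothFormOn V.curvature Set.univ := by
  rintro x₀ y ⟨hy, -⟩
  obtain ⟨α, hα⟩ := 𝒢.cover ((extChartAt (𝓡 n) x₀).symm y)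
  have hmem : (extChartAt (𝓡 n) x₀).target ∩ (extChartAt (𝓡 n) x₀).symm ⁻¹' 𝒢.U α ∈ 𝓝 y :=
    Filter.inter_mem ((isOpen_extChartAt_target x₀).mem_nhds hy)
      ((continuousAt_extChartAt_symm'' hy).preimage_mem_nhds ((𝒢.isOpen_U α).mem_nhds hα))
  have h : ContDiffAt ℝ ∞ (chartRep (extD (V.curving α)) x₀) y :=
    (((V.isSmoothFormOn_curving α).extD (𝒢.isOpen_U α)) x₀).contDiffAt hmem
  refine (h.congr_of_eventuallyEq ?_).contDiffWithinAt
  filter_upwards [hmem] with z hz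
  ext w
  exact (DFunLike.congr_fun (V.extD_curving hz.2) _).symm

/-! ### The Riemannian metric -/

/-- The metric as a continuous bilinear form on `T_x M`. -/
def metricCLM (x : M) : TangentSpace (𝓡 n) x →L[ℝ] TangentSpace (𝓡 n) x →L[ℝ] ℝ :=
  haveI : T2Space (TangentSpace (𝓡 n) x) := inferInstanceAs (T2Space (EuclideanSpace ℝ (Fin n)))
  LinearMap.toContinuousLinearMap
    (LinearMap.toContinuousLinearMap.toLinearMap.comp ((functionalOf x).comp (V.metric x)))

theorem metric_pos (x : M) (v : TangentSpace (𝓡 n) x) (hv : v ≠ 0) : 0 < V.metric x v ![v] := by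
  rw [metric_apply]
  refine V.pos x _ (V.plus_mem x v) fun h ↦ hv ?_
  rw [← V.proj_plus x v, h, map_zero]

/-- The metric of a generalized metric, as a smooth Riemannian metric on `M`. -/
def riemannianMetric : Bundle.ContMDiffRiemannianMetric (𝓡 n) ∞ (EuclideanSpace ℝ (Fin n))
    (fun x : M ↦ TangentSpace (𝓡 n) x) where
  inner := V.metricCLM
  symm := V.metric_comm
  pos := V.metric_pos
  isVonNBounded x := (NormedSpace.isVonNBounded_iff ℝ).2
    (isBounded_of_posDef (F := EuclideanSpace ℝ (Fin n)) (V.metricCLM x) (V.metric_pos x))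
  contMDiff x₀ := by
    refine contMDiffAt_hom_of_apply (E := fun x ↦ TangentSpace (𝓡 n) x →L[ℝ] ℝ) fun v ↦ ?_
    refine contMDiffAt_hom_of_apply_real fun w ↦ ?_
    have hx := mem_chart_source (EuclideanSpace ℝ (Fin n)) x₀
    exact V.contMDiffAt_metric (coordField_smooth hx v) (coordField_smooth hx w)

/-! ### The Koszul formula with torsion -/

/-- The function `g(X, Y)`. -/
def inner (X Y : VField n M) : M → ℝ := fun y ↦ V.metric y (X y) ![Y y]

theorem inner_comm (X Y : VField n M) : V.inner X Y = V.inner Y X :=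
  funext fun _ ↦ V.metric_comm _ _ _

theorem inner_add_left (X X' Y : VField n M) :
    V.inner (X + X') Y = fun y ↦ V.inner X Y y + V.inner X' Y y := funext fun y ↦ by
  change V.metric y (X y + X' y) ![Y y] = _
  rw [map_add]; rfl

theorem inner_smul_left (f : M → ℝ) (X Y : VField n M) :
    V.inner (f • X) Y = fun y ↦ f y * V.inner X Y y := funext fun y ↦ by
  change V.metric y (f y • X y) ![Y y] = _
  rw [map_smul]; rfl

theorem inner_add_right (X Y Y' : VField n M) :
    V.inner X (Y + Y') = fun y ↦ V.inner X Y y + V.inner X Y' y := by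
  rw [inner_comm, inner_add_left, V.inner_comm X, V.inner_comm X]

theorem inner_smul_right (f : M → ℝ) (X Y : VField n M) :
    V.inner X (f • Y) = fun y ↦ f y * V.inner X Y y := by
  rw [inner_comm, inner_smul_left, V.inner_comm X]

theorem mdifferentiableAt_inner {X Y : VField n M} {x : M} (hX : DiffVFieldAt X x)
    (hY : DiffVFieldAt Y x) : MDifferentiableAt (𝓡 n) 𝓘(ℝ) (V.inner X Y) x := by
  have h : MDifferentiableAt (𝓡 n) ((𝓡 n).prod 𝓘(ℝ)) (fun y ↦ TotalSpace.mk' ℝ (E := Trivial M ℝ) y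
      (V.riemannianMetric.inner y (X y) (Y y))) x :=
    MDifferentiableAt.clm_bundle_apply₂ (E₃ := Trivial M ℝ)
      ((V.riemannianMetric.contMDiff x).mdifferentiableAt (by simp)) hX hY
  exact (mdifferentiableAt_section (𝓡 n) _).1 h

/-- The right-hand side of the Koszul formula for `2 g(∇_X Y, Z)`, where `∇` is the metric
connection with torsion `g(T(X, Y), Z) = H(X, Y, Z)`. -/
def koszul (X Y Z : VField n M) (x : M) : ℝ :=
  mvfderiv (𝓡 n) (V.inner Y Z) x (X x) + mvfderiv (𝓡 n) (V.inner X Z) x (Y x)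
    - mvfderiv (𝓡 n) (V.inner X Y) x (Z x)
    + V.inner (mlieBracket (𝓡 n) X Y) Z x - V.inner (mlieBracket (𝓡 n) X Z) Y x
    - V.inner (mlieBracket (𝓡 n) Y Z) X x + V.curvature x ![X x, Y x, Z x]

section Tensoriality

variable {X Y Z X' Y' Z' : VField n M} {f : M → ℝ} {x : M}

theorem inner_mlieBracket_add_left (hX : DiffVFieldAt X x) (hX' : DiffVFieldAt X' x) :
    V.inner (mlieBracket (𝓡 n) (X + X') Y) Z x =
      V.inner (mlieBracket (𝓡 n) X Y) Z x + V.inner (mlieBracket (𝓡 n) X' Y) Z x := by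
  have : IsManifold (𝓡 n) 2 M := .of_le (n := ∞) (WithTop.coe_le_coe.2 (le_top : (2 : ℕ∞) ≤ ⊤))
  change V.metric x (mlieBracket (𝓡 n) (X + X') Y x) ![Z x] = _
  rw [mlieBracket_add_left hX hX', map_add]
  rfl

theorem inner_mlieBracket_smul_left (hf : MDifferentiableAt (𝓡 n) 𝓘(ℝ) f x)
    (hX : DiffVFieldAt X x) :
    V.inner (mlieBracket (𝓡 n) (f • X) Y) Z x =
      -(mvfderiv (𝓡 n) f x (Y x)) * V.inner X Z x + f x * V.inner (mlieBracket (𝓡 n) X Y) Z x := by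
  have : IsManifold (𝓡 n) 2 M := .of_le (n := ∞) (WithTop.coe_le_coe.2 (le_top : (2 : ℕ∞) ≤ ⊤))
  change V.metric x (mlieBracket (𝓡 n) (f • X) Y x) ![Z x] = _
  rw [mlieBracket_smul_left hf hX, map_add, map_smul, map_smul]
  rfl

theorem inner_mlieBracket_swap :
    V.inner (mlieBracket (𝓡 n) X Y) Z x = -V.inner (mlieBracket (𝓡 n) Y X) Z x := by
  change V.metric x (mlieBracket (𝓡 n) X Y x) ![Z x] = _
  rw [mlieBracket_swap]
  change V.metric x (-mlieBracket (𝓡 n) Y X x) ![Z x] = _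
  rw [map_neg]
  rfl

theorem inner_mlieBracket_add_right (hX : DiffVFieldAt X x) (hX' : DiffVFieldAt X' x) :
    V.inner (mlieBracket (𝓡 n) Y (X + X')) Z x =
      V.inner (mlieBracket (𝓡 n) Y X) Z x + V.inner (mlieBracket (𝓡 n) Y X') Z x := by
  rw [inner_mlieBracket_swap, V.inner_mlieBracket_add_left hX hX', V.inner_mlieBracket_swap (X := X),
    V.inner_mlieBracket_swap (X := X')]
  ring

theorem inner_mlieBracket_smul_right (hf : MDifferentiableAt (𝓡 n) 𝓘(ℝ) f x)
    (hX : DiffVFieldAt X x) :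
    V.inner (mlieBracket (𝓡 n) Y (f • X)) Z x =
      mvfderiv (𝓡 n) f x (Y x) * V.inner X Z x + f x * V.inner (mlieBracket (𝓡 n) Y X) Z x := by
  rw [inner_mlieBracket_swap, V.inner_mlieBracket_smul_left hf hX,
    V.inner_mlieBracket_swap (X := X)]
  ring

theorem koszul_add_left (hX : DiffVFieldAt X x) (hX' : DiffVFieldAt X' x) (hY : DiffVFieldAt Y x)
    (hZ : DiffVFieldAt Z x) :
    V.koszul (X + X') Y Z x = V.koszul X Y Z x + V.koszul X' Y Z x := by
  have e : (X + X') x = X x + X' x := rfl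
  have h1 := V.mdifferentiableAt_inner hX hZ
  have h2 := V.mdifferentiableAt_inner hX' hZ
  have h3 := V.mdifferentiableAt_inner hX hY
  have h4 := V.mdifferentiableAt_inner hX' hY
  simp only [koszul]
  rw [e, map_add, threeForm_add_left, inner_add_left, inner_add_left, inner_add_right,
    V.inner_mlieBracket_add_left hX hX', V.inner_mlieBracket_add_left hX hX',
    mvfderiv_add_apply h1 h2, mvfderiv_add_apply h3 h4]
  ring

theorem koszul_add_middle (hX : DiffVFieldAt X x) (hY : DiffVFieldAt Y x) (hY' : DiffVFieldAt Y' x)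
    (hZ : DiffVFieldAt Z x) :
    V.koszul X (Y + Y') Z x = V.koszul X Y Z x + V.koszul X Y' Z x := by
  have e : (Y + Y') x = Y x + Y' x := rfl
  simp only [koszul]
  rw [e, map_add, threeForm_add_middle, inner_add_left, inner_add_right, inner_add_right,
    V.inner_mlieBracket_add_right hY hY', V.inner_mlieBracket_add_left hY hY',
    mvfderiv_add_apply (V.mdifferentiableAt_inner hY hZ) (V.mdifferentiableAt_inner hY' hZ),
    mvfderiv_add_apply (V.mdifferentiableAt_inner hX hY) (V.mdifferentiableAt_inner hX hY')]
  ring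

theorem koszul_add_right (hX : DiffVFieldAt X x) (hY : DiffVFieldAt Y x) (hZ : DiffVFieldAt Z x)
    (hZ' : DiffVFieldAt Z' x) :
    V.koszul X Y (Z + Z') x = V.koszul X Y Z x + V.koszul X Y Z' x := by
  have e : (Z + Z') x = Z x + Z' x := rfl
  simp only [koszul]
  rw [e, map_add, threeForm_add_right, inner_add_right, inner_add_right, inner_add_right,
    V.inner_mlieBracket_add_right hZ hZ', V.inner_mlieBracket_add_right hZ hZ',
    mvfderiv_add_apply (V.mdifferentiableAt_inner hY hZ) (V.mdifferentiableAt_inner hY hZ'),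
    mvfderiv_add_apply (V.mdifferentiableAt_inner hX hZ) (V.mdifferentiableAt_inner hX hZ')]
  ring

theorem koszul_smul_left (hf : MDifferentiableAt (𝓡 n) 𝓘(ℝ) f x) (hX : DiffVFieldAt X x)
    (hY : DiffVFieldAt Y x) (hZ : DiffVFieldAt Z x) :
    V.koszul (f • X) Y Z x = f x * V.koszul X Y Z x := by
  have e : (f • X) x = f x • X x := rfl
  simp only [koszul]
  rw [e, map_smul, smul_eq_mul, threeForm_smul_left, inner_smul_left, inner_smul_left,
    inner_smul_right, V.inner_mlieBracket_smul_left hf hX, V.inner_mlieBracket_smul_left hf hX,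
    mvfderiv_mul_apply hf (V.mdifferentiableAt_inner hX hZ),
    mvfderiv_mul_apply hf (V.mdifferentiableAt_inner hX hY)]
  ring

theorem koszul_smul_right (hf : MDifferentiableAt (𝓡 n) 𝓘(ℝ) f x) (hX : DiffVFieldAt X x)
    (hY : DiffVFieldAt Y x) (hZ : DiffVFieldAt Z x) :
    V.koszul X Y (f • Z) x = f x * V.koszul X Y Z x := by
  have e : (f • Z) x = f x • Z x := rfl
  simp only [koszul]
  rw [e, map_smul, smul_eq_mul, threeForm_smul_right, inner_smul_right, inner_smul_right,
    inner_smul_right, V.inner_mlieBracket_smul_right hf hZ, V.inner_mlieBracket_smul_right hf hZ,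
    mvfderiv_mul_apply hf (V.mdifferentiableAt_inner hX hZ),
    mvfderiv_mul_apply hf (V.mdifferentiableAt_inner hY hZ), V.inner_comm Z X, V.inner_comm Z Y]
  ring

/-- The Leibniz rule for the Koszul expression. -/
theorem koszul_smul_middle (hf : MDifferentiableAt (𝓡 n) 𝓘(ℝ) f x) (hX : DiffVFieldAt X x)
    (hY : DiffVFieldAt Y x) (hZ : DiffVFieldAt Z x) :
    V.koszul X (f • Y) Z x =
      f x * V.koszul X Y Z x + 2 * (mvfderiv (𝓡 n) f x (X x) * V.inner Y Z x) := by
  have e : (f • Y) x = f x • Y x := rfl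
  simp only [koszul]
  rw [e, map_smul, smul_eq_mul, threeForm_smul_middle, inner_smul_left, inner_smul_right,
    inner_smul_right, V.inner_mlieBracket_smul_right hf hY, V.inner_mlieBracket_smul_left hf hY,
    mvfderiv_mul_apply hf (V.mdifferentiableAt_inner hY hZ),
    mvfderiv_mul_apply hf (V.mdifferentiableAt_inner hX hY), V.inner_comm Y X]
  ring

/-- The Koszul expression is compatible with the metric. -/
theorem koszul_add_koszul_swap_right :
    V.koszul X Y Z x + V.koszul X Z Y x = 2 * mvfderiv (𝓡 n) (V.inner Y Z) x (X x) := by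
  simp only [koszul]
  rw [V.inner_comm Z Y, V.inner_mlieBracket_swap (X := Z) (Y := Y),
    threeForm_swap_right _ (X x) (Y x)]
  ring

/-- The Koszul expression has torsion given by the curvature. -/
theorem koszul_sub_koszul_swap_left :
    V.koszul X Y Z x - V.koszul Y X Z x =
      2 * (V.inner (mlieBracket (𝓡 n) X Y) Z x + V.curvature x ![X x, Y x, Z x]) := by
  simp only [koszul]
  rw [V.inner_comm Y X, V.inner_mlieBracket_swap (X := Y) (Y := X),
    threeForm_swap_left _ (X x) (Y x)]
  ring

end Tensoriality

/-! ### The metric connection with skew torsion -/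

theorem eq_of_metric {x : M} {u u' : TangentSpace (𝓡 n) x}
    (h : ∀ w : TangentSpace (𝓡 n) x, V.metric x u ![w] = V.metric x u' ![w]) : u = u' := by
  by_contra hne
  have hp := V.metric_pos x (u - u') (sub_ne_zero.2 hne)
  rw [map_sub] at hp
  have h0 : (V.metric x u - V.metric x u') ![u - u'] =
    V.metric x u ![u - u'] - V.metric x u' ![u - u'] := rfl
  rw [h0, h, sub_self] at hp
  exact lt_irrefl _ hp

theorem exists_metric_eq {x : M} (f : TangentSpace (𝓡 n) x →L[ℝ] ℝ) :
    ∃ u, V.metricCLM x u = f := by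
  have hinj : Function.Injective (V.metricCLM x).toLinearMap := fun u u' h ↦
    V.eq_of_metric fun w ↦ DFunLike.congr_fun h w
  refine (LinearMap.injective_iff_surjective_of_finrank_eq_finrank ?_).1 hinj f
  exact (InnerProductSpace.toDual ℝ (EuclideanSpace ℝ (Fin n))).toLinearEquiv.finrank_eq

/-- The isomorphism `T ≅ T*` given by the metric. -/
def metricEquiv (x : M) : TangentSpace (𝓡 n) x ≃ₗ[ℝ] (TangentSpace (𝓡 n) x →L[ℝ] ℝ) :=
  LinearEquiv.ofBijective (V.metricCLM x).toLinearMap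
    ⟨fun _ _ h ↦ V.eq_of_metric fun w ↦ DFunLike.congr_fun h w, V.exists_metric_eq⟩

theorem tensorialAt_koszul_left {Y Z : VField n M} {x : M} (hY : DiffVFieldAt Y x)
    (hZ : DiffVFieldAt Z x) :
    TensorialAt (𝓡 n) (EuclideanSpace ℝ (Fin n)) (fun X ↦ V.koszul X Y Z x) x where
  smul hf hX := V.koszul_smul_left hf hX hY hZ
  add hX hX' := V.koszul_add_left hX hX' hY hZ

theorem tensorialAt_koszul_right {X Y : VField n M} {x : M} (hX : DiffVFieldAt X x)
    (hY : DiffVFieldAt Y x) :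
    TensorialAt (𝓡 n) (EuclideanSpace ℝ (Fin n)) (fun Z ↦ V.koszul X Y Z x) x where
  smul hf hZ := V.koszul_smul_right hf hX hY hZ
  add hZ hZ' := V.koszul_add_right hX hY hZ hZ'

/-- The Koszul expression at `x` as a bilinear form in the vectors `X` and `Z`. -/
def koszulCLM {Y : VField n M} {x : M} (hY : DiffVFieldAt Y x) :
    TangentSpace (𝓡 n) x →L[ℝ] TangentSpace (𝓡 n) x →L[ℝ] ℝ :=
  TensorialAt.mkHom₂ (I := 𝓡 n) (F := EuclideanSpace ℝ (Fin n)) (F' := EuclideanSpace ℝ (Fin n))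
    (fun X Z ↦ V.koszul X Y Z x) x (fun _ hZ ↦ V.tensorialAt_koszul_left hY hZ)
    (fun _ hX ↦ V.tensorialAt_koszul_right hX hY)

theorem koszulCLM_apply {X Y Z : VField n M} {x : M} (hX : DiffVFieldAt X x)
    (hY : DiffVFieldAt Y x) (hZ : DiffVFieldAt Z x) :
    V.koszulCLM hY (X x) (Z x) = V.koszul X Y Z x :=
  TensorialAt.mkHom₂_apply _ _ hX hZ

open Classical in
/-- The covariant derivative determined by `2 g(∇_X Y, Z) = koszul X Y Z`; its value is zero at the
points at which `Y` is not differentiable. -/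
def covDeriv (Y : VField n M) (x : M) : TangentSpace (𝓡 n) x →L[ℝ] TangentSpace (𝓡 n) x :=
  if hY : DiffVFieldAt Y x then
    haveI : T2Space (TangentSpace (𝓡 n) x) := inferInstanceAs (T2Space (EuclideanSpace ℝ (Fin n)))
    LinearMap.toContinuousLinearMap ((1 / 2 : ℝ) • (V.metricEquiv x).symm.toLinearMap.comp
      (V.koszulCLM hY : TangentSpace (𝓡 n) x →ₗ[ℝ] (TangentSpace (𝓡 n) x →L[ℝ] ℝ)))
  else 0

theorem two_mul_metric_covDeriv {X Y Z : VField n M} {x : M} (hX : DiffVFieldAt X x)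
    (hY : DiffVFieldAt Y x) (hZ : DiffVFieldAt Z x) :
    2 * V.metric x (V.covDeriv Y x (X x)) ![Z x] = V.koszul X Y Z x := by
  have h1 : V.covDeriv Y x (X x) =
      (1 / 2 : ℝ) • (V.metricEquiv x).symm (V.koszulCLM hY (X x)) := by
    rw [covDeriv, dif_pos hY]; rfl
  have h2 : V.metric x ((V.metricEquiv x).symm (V.koszulCLM hY (X x))) ![Z x] =
      V.koszulCLM hY (X x) (Z x) :=
    DFunLike.congr_fun ((V.metricEquiv x).apply_symm_apply (V.koszulCLM hY (X x))) (Z x)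
  have h3 : V.metric x ((1 / 2 : ℝ) • (V.metricEquiv x).symm (V.koszulCLM hY (X x))) ![Z x] =
      1 / 2 * V.metric x ((V.metricEquiv x).symm (V.koszulCLM hY (X x))) ![Z x] := by
    rw [map_smul]; rfl
  rw [h1, h3, h2, V.koszulCLM_apply hX hY hZ]
  ring

/-- The connection on `T` with `2 g(∇_X Y, Z) = koszul X Y Z`. -/
def connection : CovariantDerivative (𝓡 n) (EuclideanSpace ℝ (Fin n))
    (fun x : M ↦ TangentSpace (𝓡 n) x) where
  toFun := V.covDeriv
  isCovariantDerivativeOnUniv :=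
    { add := by
        intro Y Y' x hY hY' _
        have hs : DiffVFieldAt (Y + Y') x := mdifferentiableAt_add_section hY hY'
        refine ContinuousLinearMap.ext fun v ↦ V.eq_of_metric fun w ↦ ?_
        obtain ⟨X, hX, rfl⟩ := exists_smoothVFieldAt x v
        obtain ⟨Z, hZ, rfl⟩ := exists_smoothVFieldAt x w
        have h := V.koszul_add_middle hX.diff hY hY' hZ.diff
        rw [← V.two_mul_metric_covDeriv hX.diff hs hZ.diff,
          ← V.two_mul_metric_covDeriv hX.diff hY hZ.diff,
          ← V.two_mul_metric_covDeriv hX.diff hY' hZ.diff] at h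
        change _ = V.metric x (V.covDeriv Y x (X x) + V.covDeriv Y' x (X x)) ![Z x]
        rw [map_add]
        change _ = V.metric x (V.covDeriv Y x (X x)) ![Z x] +
          V.metric x (V.covDeriv Y' x (X x)) ![Z x]
        linarith
      leibniz := by
        intro Y f x hY hf _
        have hs : DiffVFieldAt (f • Y) x := hf.smul_section hY
        refine ContinuousLinearMap.ext fun v ↦ V.eq_of_metric fun w ↦ ?_
        obtain ⟨X, hX, rfl⟩ := exists_smoothVFieldAt x v
        obtain ⟨Z, hZ, rfl⟩ := exists_smoothVFieldAt x w
        have h := V.koszul_smul_middle hf hX.diff hY hZ.diff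
        rw [← V.two_mul_metric_covDeriv hX.diff hs hZ.diff,
          ← V.two_mul_metric_covDeriv hX.diff hY hZ.diff] at h
        change _ = V.metric x (f x • V.covDeriv Y x (X x) + mvfderiv (𝓡 n) f x (X x) • Y x) ![Z x]
        rw [map_add, map_smul, map_smul]
        change _ = f x * V.metric x (V.covDeriv Y x (X x)) ![Z x] +
          mvfderiv (𝓡 n) f x (X x) * V.inner Y Z x
        linarith }

theorem isMetricConnection_connection : V.IsMetricConnection V.connection := by
  intro X Y Z hX hY hZ x
  have hX' : DiffVFieldAt X x := SmoothVFieldAt.diff (hX.contMDiffAt Filter.univ_mem)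
  have hY' : DiffVFieldAt Y x := SmoothVFieldAt.diff (hY.contMDiffAt Filter.univ_mem)
  have hZ' : DiffVFieldAt Z x := SmoothVFieldAt.diff (hZ.contMDiffAt Filter.univ_mem)
  have h := V.koszul_add_koszul_swap_right (X := X) (Y := Y) (Z := Z) (x := x)
  rw [← V.two_mul_metric_covDeriv hX' hY' hZ', ← V.two_mul_metric_covDeriv hX' hZ' hY',
    V.metric_comm x _ (Y x)] at h
  change mvfderiv (𝓡 n) (V.inner Y Z) x (X x) =
    V.metric x (V.covDeriv Y x (X x)) ![Z x] + V.metric x (Y x) ![V.covDeriv Z x (X x)]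
  linarith

theorem hasSkewTorsion_connection : V.HasSkewTorsion V.connection (fun x ↦ -V.curvature x) := by
  intro x v w
  refine oneForm_ext fun z ↦ ?_
  obtain ⟨X, hX, rfl⟩ := exists_smoothVFieldAt x v
  obtain ⟨Y, hY, rfl⟩ := exists_smoothVFieldAt x w
  obtain ⟨Z, hZ, rfl⟩ := exists_smoothVFieldAt x z
  have : IsManifold (𝓡 n) 2 M := .of_le (n := ∞) (WithTop.coe_le_coe.2 (le_top : (2 : ℕ∞) ≤ ⊤))
  rw [V.connection.torsion_apply hX.diff hY.diff, map_sub, map_sub]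
  have h := V.koszul_sub_koszul_swap_left (X := X) (Y := Y) (Z := Z) (x := x)
  rw [← V.two_mul_metric_covDeriv hX.diff hY.diff hZ.diff,
    ← V.two_mul_metric_covDeriv hY.diff hX.diff hZ.diff] at h
  -- `i_X i_Y (-H)` is `Z ↦ -H(Y, X, Z) = H(X, Y, Z)`
  have h2 := threeForm_swap_left (V.curvature x) (X x) (Y x) (Z x)
  change V.metric x (V.covDeriv Y x (X x)) ![Z x] - V.metric x (V.covDeriv X x (Y x)) ![Z x]
    - V.inner (mlieBracket (𝓡 n) X Y) Z x = -(V.curvature x ![Y x, X x, Z x])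
  linarith

/-! ### Smoothness of the connection -/

/-- The matrix of the metric at `y` in the coordinates at `x₀`, as a bilinear form. -/
def gram (x₀ y : M) : EuclideanSpace ℝ (Fin n) →L[ℝ] EuclideanSpace ℝ (Fin n) →L[ℝ] ℝ :=
  LinearMap.toContinuousBilinearMap <|
    LinearMap.mk₂ ℝ (fun v w ↦ V.metric y (coordField x₀ v y) ![coordField x₀ w y])
      (fun v v' w ↦ by rw [coordField_add, map_add]; rfl)
      (fun c v w ↦ by rw [coordField_const_smul, map_smul]; rfl)
      (fun v w w' ↦ by rw [coordField_add, oneForm_add])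
      (fun c v w ↦ by rw [coordField_const_smul, oneForm_smul]; rfl)

theorem gram_apply (x₀ y : M) (v w : EuclideanSpace ℝ (Fin n)) :
    V.gram x₀ y v w = V.metric y (coordField x₀ v y) ![coordField x₀ w y] := rfl

theorem contMDiffAt_gram (x₀ : M) : ContMDiffAt (𝓡 n)
    𝓘(ℝ, EuclideanSpace ℝ (Fin n) →L[ℝ] EuclideanSpace ℝ (Fin n) →L[ℝ] ℝ) ∞ (V.gram x₀) x₀ := by
  have hx := mem_chart_source (EuclideanSpace ℝ (Fin n)) x₀
  exact contMDiffAt_clm_of_apply fun v ↦ contMDiffAt_clm_of_apply fun w ↦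
    V.contMDiffAt_metric (coordField_smooth hx v) (coordField_smooth hx w)

theorem exists_gram_eq {x₀ y : M} (hy : y ∈ (chartAt (EuclideanSpace ℝ (Fin n)) x₀).source) :
    ∃ Q : EuclideanSpace ℝ (Fin n) ≃L[ℝ] (EuclideanSpace ℝ (Fin n) →L[ℝ] ℝ), V.gram x₀ y = Q := by
  have hinj : Function.Injective (V.gram x₀ y).toLinearMap := by
    rw [← LinearMap.ker_eq_bot, LinearMap.ker_eq_bot']
    intro v hv
    by_contra hne
    have h0 : coordField x₀ v y ≠ 0 := fun h0 ↦ hne <| by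
      have h1 := mfderiv_mfderiv_symm_extChartAt (x₀ := x₀) (x := y) (by simpa using hy) v
      refine h1.symm.trans ?_
      change mfderiv (𝓡 n) 𝓘(ℝ, EuclideanSpace ℝ (Fin n)) (extChartAt (𝓡 n) x₀) y
        (coordField x₀ v y) = 0
      rw [h0]
      exact map_zero _
    have hp := V.metric_pos y _ h0
    have h2 : V.gram x₀ y v v = 0 := DFunLike.congr_fun hv v
    rw [gram_apply] at h2
    exact hp.ne' h2
  have hsurj := (LinearMap.injective_iff_surjective_of_finrank_eq_finrank
    (InnerProductSpace.toDual ℝ (EuclideanSpace ℝ (Fin n))).toLinearEquiv.finrank_eq).1 hinj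
  exact ⟨(LinearEquiv.ofBijective _ ⟨hinj, hsurj⟩).toContinuousLinearEquiv, rfl⟩

/-- A vector field is smooth if its inner products with the coordinate vector fields are. -/
theorem smoothVFieldAt_of_metric {X : VField n M} {x₀ : M}
    (h : ∀ w : EuclideanSpace ℝ (Fin n), ContMDiffAt (𝓡 n) 𝓘(ℝ) ∞
      (V.inner X (coordField x₀ w)) x₀) : SmoothVFieldAt X x₀ := by
  have hx := mem_chart_source (EuclideanSpace ℝ (Fin n)) x₀
  rw [smoothVFieldAt_iff_vfieldRep hx]
  have h1 : ContMDiffAt (𝓡 n) 𝓘(ℝ, EuclideanSpace ℝ (Fin n) →L[ℝ] ℝ) ∞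
      (fun y ↦ V.gram x₀ y (vfieldRep x₀ X y)) x₀ := by
    refine contMDiffAt_clm_of_apply fun w ↦ (h w).congr_of_eventuallyEq ?_
    filter_upwards [(chartAt (EuclideanSpace ℝ (Fin n)) x₀).open_source.mem_nhds hx] with y hy
    rw [gram_apply]
    have e : coordField x₀ (vfieldRep x₀ X y) y = X y :=
      mfderiv_symm_mfderiv_extChartAt (by simpa using hy) (X y)
    rw [e]
    rfl
  obtain ⟨Q, hQ⟩ := V.exists_gram_eq hx
  have hinv : ContMDiffAt 𝓘(ℝ, EuclideanSpace ℝ (Fin n) →L[ℝ] EuclideanSpace ℝ (Fin n) →L[ℝ] ℝ)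
      𝓘(ℝ, (EuclideanSpace ℝ (Fin n) →L[ℝ] ℝ) →L[ℝ] EuclideanSpace ℝ (Fin n)) ∞
      ContinuousLinearMap.inverse (V.gram x₀ x₀) := by
    rw [hQ]; exact (contDiffAt_map_inverse Q).contMDiffAt
  refine ((hinv.comp x₀ (V.contMDiffAt_gram x₀)).clm_apply h1).congr_of_eventuallyEq ?_
  filter_upwards [(chartAt (EuclideanSpace ℝ (Fin n)) x₀).open_source.mem_nhds hx] with y hy
  obtain ⟨Q, hQ⟩ := V.exists_gram_eq hy
  change _ = (V.gram x₀ y).inverse (V.gram x₀ y (vfieldRep x₀ X y))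
  rw [hQ, ContinuousLinearMap.inverse_equiv]
  exact (Q.symm_apply_apply _).symm

theorem contMDiffAt_inner {X Y : VField n M} {x : M} (hX : SmoothVFieldAt X x)
    (hY : SmoothVFieldAt Y x) : ContMDiffAt (𝓡 n) 𝓘(ℝ) ∞ (V.inner X Y) x :=
  V.contMDiffAt_metric hX hY

theorem contMDiffAt_koszul {X Y Z : VField n M} {U : Set M} (hU : IsOpen U)
    (hX : ∀ y ∈ U, SmoothVFieldAt X y) (hY : ∀ y ∈ U, SmoothVFieldAt Y y)
    (hZ : ∀ y ∈ U, SmoothVFieldAt Z y) {x : M} (hx : x ∈ U) :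
    ContMDiffAt (𝓡 n) 𝓘(ℝ) ∞ (V.koszul X Y Z) x := by
  have h1 := contMDiffAt_mvfderiv_apply hU hx
    (fun y hy ↦ V.contMDiffAt_inner (hY y hy) (hZ y hy)) (hX x hx)
  have h2 := contMDiffAt_mvfderiv_apply hU hx
    (fun y hy ↦ V.contMDiffAt_inner (hX y hy) (hZ y hy)) (hY x hx)
  have h3 := contMDiffAt_mvfderiv_apply hU hx
    (fun y hy ↦ V.contMDiffAt_inner (hX y hy) (hY y hy)) (hZ x hx)
  have h4 := V.contMDiffAt_inner ((hX x hx).mlieBracket (hY x hx)) (hZ x hx)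
  have h5 := V.contMDiffAt_inner ((hX x hx).mlieBracket (hZ x hx)) (hY x hx)
  have h6 := V.contMDiffAt_inner ((hY x hx).mlieBracket (hZ x hx)) (hX x hx)
  have h7 := V.isSmoothFormOn_curvature.apply_three isOpen_univ (Set.mem_univ x) (hX x hx)
    (hY x hx) (hZ x hx)
  exact (((((h1.add h2).sub h3).add h4).sub h5).sub h6).add h7

theorem contMDiffCovariantDerivative_connection :
    V.connection.ContMDiffCovariantDerivative ∞ where
  contMDiff :=
    { contMDiff := by
        intro Y hY x₀ _
        have hY' : ∀ y, SmoothVFieldAt Y y := fun y ↦ (hY.contMDiffAt Filter.univ_mem).of_le (by simp)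
        refine ContMDiffAt.contMDiffWithinAt ?_
        refine contMDiffAt_hom_of_apply (E := fun x : M ↦ TangentSpace (𝓡 n) x) fun v ↦ ?_
        refine V.smoothVFieldAt_of_metric fun w ↦ ?_
        have hx := mem_chart_source (EuclideanSpace ℝ (Fin n)) x₀
        have hU := (chartAt (EuclideanSpace ℝ (Fin n)) x₀).open_source
        have h := V.contMDiffAt_koszul hU (fun y hy ↦ coordField_smooth hy v) (fun y _ ↦ hY' y)
          (fun y hy ↦ coordField_smooth hy w) hx
        refine ((contMDiffAt_const (c := (1 / 2 : ℝ)) (I' := 𝓘(ℝ))).mul h).congr_of_eventuallyEq ?_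
        filter_upwards [hU.mem_nhds hx] with y hy
        have h2 := V.two_mul_metric_covDeriv (coordField_smooth hy v).diff (hY' y).diff
          (coordField_smooth hy w).diff
        change V.metric y (V.covDeriv Y y (coordField x₀ v y)) ![coordField x₀ w y] =
          1 / 2 * V.koszul (coordField x₀ v) Y (coordField x₀ w) y
        rw [← h2]
        ring }

/-! ### The Courant bracket of the lifts -/

/-- In a trivialization of `E`, the Courant bracket `[X⁻, Y⁺]` exceeds `[X, Y]⁻` by the one-form
given by the Koszul expression. -/
theorem courantForm_sub_rep_minus {X Y Z : VField n M} (hX : IsSmoothVFieldOn X Set.univ)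
    (hY : IsSmoothVFieldOn Y Set.univ) {α : ι} {x : M} (hα : x ∈ 𝒢.U α) (hZ : SmoothVFieldAt Z x) :
    courantForm X (𝒢.repForm (fun y ↦ V.minus y (X y)) α) Y
        (𝒢.repForm (fun y ↦ V.plus y (Y y)) α) x ![Z x]
      - 𝒢.rep ⟨α, hα⟩ (V.minus x (mlieBracket (𝓡 n) X Y x)) ![Z x] = V.koszul X Y Z x := by
  have hX' : SmoothVFieldAt X x := hX.contMDiffAt Filter.univ_mem
  have hY' : SmoothVFieldAt Y x := hY.contMDiffAt Filter.univ_mem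
  have hU := 𝒢.isOpen_U α
  have ha : IsSmoothFormOn (𝒢.repForm (fun y ↦ V.minus y (X y)) α) (𝒢.U α) := by
    simpa only [Set.inter_univ] using (V.isSmoothSectionOn_minus hX).rep α
  have hb : IsSmoothFormOn (𝒢.repForm (fun y ↦ V.plus y (Y y)) α) (𝒢.U α) := by
    simpa only [Set.inter_univ] using (V.isSmoothSectionOn_plus hY).rep α
  have pa : ∀ y ∈ 𝒢.U α, ∀ w : TangentSpace (𝓡 n) y,
      𝒢.repForm (fun y ↦ V.minus y (X y)) α y ![w] =
        V.curving α y ![X y, w] - V.metric y (X y) ![w] := fun y hy w ↦ by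
    rw [repForm_apply _ hy, rep_minus_eq]
  have pb : ∀ y ∈ 𝒢.U α, ∀ w : TangentSpace (𝓡 n) y,
      𝒢.repForm (fun y ↦ V.plus y (Y y)) α y ![w] =
        V.curving α y ![Y y, w] + V.metric y (Y y) ![w] := fun y hy w ↦ by
    rw [repForm_apply _ hy, rep_plus_eq]
  have dB : ∀ {P Q : VField n M}, SmoothVFieldAt P x → SmoothVFieldAt Q x →
      MDifferentiableAt (𝓡 n) 𝓘(ℝ) (fun y ↦ V.curving α y ![P y, Q y]) x := fun hP hQ ↦
    ((V.isSmoothFormOn_curving α).apply_two hU hα hP hQ).mdifferentiableAt (by simp)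
  have qa : ∀ {P : VField n M}, SmoothVFieldAt P x → ∀ v : TangentSpace (𝓡 n) x,
      mvfderiv (𝓡 n) (fun y ↦ 𝒢.repForm (fun y ↦ V.minus y (X y)) α y ![P y]) x v =
        mvfderiv (𝓡 n) (fun y ↦ V.curving α y ![X y, P y]) x v
          - mvfderiv (𝓡 n) (V.inner X P) x v := fun {P} hP v ↦ by
    rw [← mvfderiv_sub_apply (dB hX' hP) (V.mdifferentiableAt_inner hX'.diff hP.diff)]
    refine mvfderiv_congr_apply ?_ v
    filter_upwards [hU.mem_nhds hα] with y hy using pa y hy _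
  have qb : ∀ {P : VField n M}, SmoothVFieldAt P x → ∀ v : TangentSpace (𝓡 n) x,
      mvfderiv (𝓡 n) (fun y ↦ 𝒢.repForm (fun y ↦ V.plus y (Y y)) α y ![P y]) x v =
        mvfderiv (𝓡 n) (fun y ↦ V.curving α y ![Y y, P y]) x v
          + mvfderiv (𝓡 n) (V.inner Y P) x v := fun {P} hP v ↦ by
    rw [← mvfderiv_add_apply (dB hY' hP) (V.mdifferentiableAt_inner hY'.diff hP.diff)]
    refine mvfderiv_congr_apply ?_ v
    filter_upwards [hU.mem_nhds hα] with y hy using pb y hy _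
  -- `B(Y, X) = -B(X, Y)`
  have hswap : mvfderiv (𝓡 n) (fun y ↦ V.curving α y ![Y y, X y]) x (Z x) =
      -mvfderiv (𝓡 n) (fun y ↦ V.curving α y ![X y, Y y]) x (Z x) := by
    have h0 := mvfderiv_add_apply (dB hY' hX') (dB hX' hY') (Z x)
    have h1 : (fun y ↦ V.curving α y ![Y y, X y] + V.curving α y ![X y, Y y]) = fun _ ↦ (0 : ℝ) :=
      funext fun y ↦ by rw [twoForm_swap _ (X y)]; ring
    rw [h1, mvfderiv_const] at h0
    have h2 : (0 : TangentSpace (𝓡 n) x →L[ℝ] ℝ) (Z x) = 0 := rfl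
    linarith
  have hH : V.curvature x ![X x, Y x, Z x] = _ := (DFunLike.congr_fun (V.extD_curving hα)
    ![X x, Y x, Z x]).symm.trans (extD_two_apply (V.isSmoothFormOn_curving α) hU hα hX'.diff
      hY'.diff hZ.diff)
  rw [courantForm_apply ha hb hU hα hX' hY' hZ, qa hZ, qa hY', qb hZ, qb hX', pa x hα, pb x hα,
    rep_minus_eq, hswap, V.inner_comm Y X, koszul, hH]
  have s1 := twoForm_swap (V.curving α x) (mlieBracket (𝓡 n) X Z x) (Y x)
  have s2 := twoForm_swap (V.curving α x) (mlieBracket (𝓡 n) Y Z x) (X x)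
  have s3 := V.metric_comm x (Y x) (mlieBracket (𝓡 n) X Z x)
  have s4 := V.metric_comm x (X x) (mlieBracket (𝓡 n) Y Z x)
  -- the terms in `B` make up `dB(X, Y, Z)`, those in the metric the Koszul formula
  simp only [inner] at *
  linarith

/-- The Courant bracket determines the connection: `[X⁻, Y⁺] - [X, Y]⁻ = 2 g ∇_X Y`. -/
theorem courantBracket_sub_minus {X Y : VField n M} (hX : IsSmoothVFieldOn X Set.univ)
    (hY : IsSmoothVFieldOn Y Set.univ) (x : M) :
    𝒢.courantBracket (fun y ↦ V.minus y (X y)) (fun y ↦ V.plus y (Y y)) x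
        - 𝒢.toAmbient x (V.minus x (mlieBracket (𝓡 n) X Y x)) =
      𝒢.toAmbient x (𝒢.ofCovector x ((2 : ℝ) • V.metric x (V.connection Y x (X x)))) := by
  have hX' : SmoothVFieldAt X x := hX.contMDiffAt Filter.univ_mem
  have hY' : SmoothVFieldAt Y x := hY.contMDiffAt Filter.univ_mem
  have pX : (fun y ↦ 𝒢.proj y (V.minus y (X y))) = X := funext fun y ↦ V.proj_minus y _
  have pY : (fun y ↦ 𝒢.proj y (V.plus y (Y y))) = Y := funext fun y ↦ V.proj_plus y _
  simp only [courantBracket, pX, pY]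
  refine Prod.ext ?_ (funext fun ⟨α, hα⟩ ↦ oneForm_ext fun w ↦ ?_)
  · change mlieBracket (𝓡 n) X Y x - 𝒢.proj x (V.minus x (mlieBracket (𝓡 n) X Y x)) = 0
    rw [proj_minus, sub_self]
  · obtain ⟨Z, hZ, rfl⟩ := exists_smoothVFieldAt x w
    refine (V.courantForm_sub_rep_minus hX hY hα hZ).trans ?_
    exact (V.two_mul_metric_covDeriv hX'.diff hY'.diff hZ.diff).symm

end GeneralizedMetric

end ConnectiveGerbe

end GenGeom

end

theorem mainTheorem1 (n : ℕ) (M : Type*) [TopologicalSpace M] [T2Space M]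
    [SecondCountableTopology M] [ChartedSpace (EuclideanSpace ℝ (Fin n)) M]
    [IsManifold (𝓡 n) ∞ M] (ι : Type*) (𝒢 : GenGeom.ConnectiveGerbe n M ι)
    (V : 𝒢.GeneralizedMetric) :
    -- half the difference of the two splittings is a smooth Riemannian metric
    (∃ g : Bundle.ContMDiffRiemannianMetric (𝓡 n) ∞ (EuclideanSpace ℝ (Fin n))
        (fun x : M ↦ TangentSpace (𝓡 n) x), ∀ x v w, g.inner x v w = V.metric x v ![w]) ∧
    -- the average of the two splittings is a curving, with curvature `H`
    𝒢.IsCurving V.curving ∧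
    (∀ α, ∀ x ∈ 𝒢.U α, GenGeom.extD (V.curving α) x = V.curvature x) ∧
    -- the lifts of a smooth vector field are smooth sections of `E`
    (∀ X : GenGeom.VField n M, GenGeom.IsSmoothVFieldOn X Set.univ →
      𝒢.IsSmoothSectionOn (fun x ↦ V.plus x (X x)) Set.univ ∧
      𝒢.IsSmoothSectionOn (fun x ↦ V.minus x (X x)) Set.univ) ∧
    -- `[X⁻, Y⁺] - [X, Y]⁻ = 2 g ∇_X Y` for a smooth metric connection with skew torsion `-H`
    ∃ D : CovariantDerivative (𝓡 n) (EuclideanSpace ℝ (Fin n))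
        (fun x : M ↦ TangentSpace (𝓡 n) x),
      D.ContMDiffCovariantDerivative ∞ ∧
      (∀ X Y : GenGeom.VField n M, GenGeom.IsSmoothVFieldOn X Set.univ →
        GenGeom.IsSmoothVFieldOn Y Set.univ → ∀ x : M,
        𝒢.courantBracket (fun y ↦ V.minus y (X y)) (fun y ↦ V.plus y (Y y)) x
            - 𝒢.toAmbient x (V.minus x (VectorField.mlieBracket (𝓡 n) X Y x)) =
          𝒢.toAmbient x (𝒢.ofCovector x ((2 : ℝ) • V.metric x (D Y x (X x))))) ∧
      V.IsMetricConnection D ∧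
      V.HasSkewTorsion D (fun x ↦ -V.curvature x) :=
  ⟨⟨V.riemannianMetric, fun _ _ _ ↦ rfl⟩, V.isCurving_curving, fun _ _ hx ↦ V.extD_curving hx,
    fun _ hX ↦ ⟨V.isSmoothSectionOn_plus hX, V.isSmoothSectionOn_minus hX⟩, V.connection,
    V.contMDiffCovariantDerivative_connection, fun _ _ hX hY x ↦ V.courantBracket_sub_minus hX hY x,
    V.isMetricConnection_connection, V.hasSkewTorsion_connection⟩
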